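/- **Setting.** Let $U\subseteq\mathbb R^d$ be open (the domain of $f$; e.g. $U=\mathbb R^d$) and let $f:U\to\mathbb R$ be differentiable and bounded below. Assume that $f$ is $(L_0,L_\rho)$-smooth with $0\le\rho<2$ and $L_0,L_\rho\ge 0$, i.e. $f$ is twice differentiable on $U$ and $\|\nabla^2 f(x)\|\le L_0+L_\rho\|\nabla f(x)\|^{\rho}$ for almost every $x\in U$ (spectral and Euclidean norms). Adam with parameters $\beta,\beta_{\rm sq},\eta,\lambda>0$ started at $x_1\in U$ is the iteration ($m_0=v_0=0$; squares, square roots, quotients and $\odot$ are coordinate-wise), for $t=1,\dots,T$, $$m_t=(1-\beta)m_{t-1}+\beta g_t,\quad v_t=(1-\beta_{\rm sq})v_{t-1}+\beta_{\rm sq}g_t^2,\quad \hat m_t=\frac{m_t}{1-(1-\beta)^t},\quad \hat v_t=\frac{v_t}{1-(1-\beta_{\rm sq})^t},\quad x_{t+1}=x_t-\frac{\eta}{\sqrt{\hat v_t}+\lambda}\odot\hat m_t ,$$ where $g_t=\nabla f(x_t,\xi_t)$ is the stochastic gradient for the random sample $\xi_t$. Assume that for $1\le t\le T$ one has $\mathbb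 E[g_t-\nabla f(x_t)\mid\xi_1,\dots,\xi_{t-1}]=0$ and $\|g_t-\nabla f(x_t)\|\le\sigma$ almost surely, and that almost surely the iteration runs inside $U$, i.e. the segments $[x_t,x_{t+1}]$, $1\le t\le T$, lie in $U$ (no condition if $U=\mathbb R^d$). Put $\Delta_1=f(x_1)-\inf_U f$ and, for $G>0$, $$r=\min\Big\{\frac1{5L_\rho G^{\rho-1}},\frac1{5(L_0^{\rho-1}L_\rho)^{1/\rho}}\Big\},\qquad L=3L_0+4L_\rho G^\rho ,$$ where here and below $a/0=+\infty$ for $a>0$, and the second entry of $r$ is omitted if $\rho=0$ or $L_0=0$. **Theorem.** For all sufficiently large numerical constants $C_1,C_2$ and all $c_1,c_2>0$ that are sufficiently small (depending only on $C_1,C_2$) the following holds. Let $0<\delta<1$, $\iota=\max\{1,\log(1/\delta)\}$, $\epsilon>0$, $\lambda>0$, let $$G\ge\max\Big\{2\lambda,\,2\sigma,\,2\|\nabla f(x_1)\|,\,\sqrt{C_1\Delta_1L_0\sqrt d},\,(C_1\Delta_1L_\rho\sqrt d)^{\frac1{2-\rho}}\Big\},$$ and choose $\beta,\eta>0$ and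 $T$ with $$\beta_{\rm sq}=\beta\le\min\Big\{1,\frac{c_1\lambda\epsilon^2}{\sigma^2G\sqrt\iota}\Big\},\quad \eta\le c_2\min\Big\{\frac r{\sqrt d},\frac{\lambda\beta}{\sqrt{d\iota}\,L},\frac{\lambda^{3/2}\beta}{L\sqrt G}\Big\},\quad T=\Big\lceil\max\Big\{\frac1{\beta^2},\frac{C_2\Delta_1G}{\eta\epsilon^2}\Big\}\Big\rceil .$$ Then with probability at least $1-\delta$ one has $\|\nabla f(x_t)\|\le G$ for all $1\le t\le T$ and $$\frac1T\sum_{t=1}^T\|\nabla f(x_t)\|^2\le\epsilon^2 .$$ Moreover the gradient complexity is $O\big(d^{\,p}\epsilon^{-4}\big)$ with $p=\max\{\frac2{2-\rho},\frac{5+2\rho}{4(2-\rho)}\}$: given $\rho,L_0,L_\rho,\lambda,\sigma,\delta,\Delta_1,\|\nabla f(x_1)\|$ (and $c_1,c_2,C_1,C_2$) there is a constant $K$ such that for all $d\ge1$ and $0<\epsilon\le1$ there are $G,\beta,\eta$ as above for which $T\le K d^{\,p}\epsilon^{-4}$. -/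

import Mathlib

open MeasureTheory
open scoped ENNReal

universe u v

noncomputable section

/-- `ℝᵈ` with the Euclidean norm. -/
abbrev RVec (d : ℕ) : Type := EuclideanSpace ℝ (Fin d)

/-! ### The Adam algorithm -/

/-- The variables of Adam at the end of iteration `t` (iteration `0` is the initialization):
the momenta `m_t`, `v_t` and the point `x_{t+1}`. -/
structure AdamState (d : ℕ) where
  m : RVec d
  v : RVec d
  x : RVec d

/-- Iteration `t ≥ 1` of Adam with stochastic gradient oracle `g x z = ∇f(x, z)` and sample `z`:
momentum updates, bias corrections and the coordinate-wise step. -/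
def adamStep {d : ℕ} {Ξ : Type v} (g : RVec d → Ξ → RVec d) (β β₂ η lam : ℝ)
    (t : ℕ) (z : Ξ) (s : AdamState d) : AdamState d :=
  let m : RVec d := WithLp.toLp 2 fun i => (1 - β) * s.m i + β * g s.x z i
  let v : RVec d := WithLp.toLp 2 fun i => (1 - β₂) * s.v i + β₂ * (g s.x z i) ^ 2
  let mhat : RVec d := WithLp.toLp 2 fun i => m i / (1 - (1 - β) ^ t)
  let vhat : RVec d := WithLp.toLp 2 fun i => v i / (1 - (1 - β₂) ^ t)
  { m := m
    v := v
    x := WithLp.toLp 2 fun i => s.x i - η / (Real.sqrt (vhat i) + lam) * mhat i }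

/-- The state after `t` iterations, when iteration `s` uses the sample `z s` (`s = 1, 2, …`). -/
def adamState {d : ℕ} {Ξ : Type v} (g : RVec d → Ξ → RVec d) (β β₂ η lam : ℝ)
    (xinit : RVec d) (z : ℕ → Ξ) : ℕ → AdamState d
  | 0 => { m := 0, v := 0, x := xinit }
  | t + 1 => adamStep g β β₂ η lam (t + 1) (z (t + 1)) (adamState g β β₂ η lam xinit z t)

/-- The iterate `x_t`, `t ≥ 1`; in particular `x_1 = xinit`. -/
def adamIter {d : ℕ} {Ξ : Type v} (g : RVec d → Ξ → RVec d) (β β₂ η lam : ℝ)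
    (xinit : RVec d) (z : ℕ → Ξ) (t : ℕ) : RVec d :=
  (adamState g β β₂ η lam xinit z (t - 1)).x

/-! ### The function class -/

/-- `f` is twice differentiable on the open set `U`, and its Hessian (the derivative of the
gradient, with the operator norm) satisfies `‖∇²f(x)‖ ≤ L₀ + L_ρ ‖∇f(x)‖ ^ ρ` for almost
every `x ∈ U`. -/
def IsL0LrhoSmooth {d : ℕ} (U : Set (RVec d)) (f : RVec d → ℝ) (ρ L₀ Lρ : ℝ) : Prop :=
  (∀ x ∈ U, DifferentiableAt ℝ (gradient f) x) ∧
    ∀ᵐ x ∂(volume : Measure (RVec d)), x ∈ U →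
      ‖fderiv ℝ (gradient f) x‖ ≤ L₀ + Lρ * ‖gradient f x‖ ^ ρ

/-! ### The noise -/

/-- The σ-algebra generated by `ξ_1, …, ξ_{t-1}`. -/
abbrev samplesBefore {Ω : Type u} {Ξ : Type v} [MeasurableSpace Ξ] (ξ : ℕ → Ω → Ξ) (t : ℕ) :
    MeasurableSpace Ω :=
  ⨆ (s : ℕ) (_ : 1 ≤ s ∧ s < t), MeasurableSpace.comap (ξ s) inferInstance

/-- The noise of the stochastic gradients `g (x t) (ξ t)`, `1 ≤ t ≤ T`, is conditionally centered
given the earlier samples and almost surely bounded by `σ`. (The centering is written for the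
noise, which is bounded and hence integrable.) -/
def CenteredBoundedNoise {d : ℕ} {Ω : Type u} {Ξ : Type v} [MeasurableSpace Ω]
    [MeasurableSpace Ξ] (μ : Measure Ω) (f : RVec d → ℝ) (g : RVec d → Ξ → RVec d)
    (ξ : ℕ → Ω → Ξ) (x : ℕ → Ω → RVec d) (σ : ℝ) (T : ℕ) : Prop :=
  ∀ t : ℕ, 1 ≤ t → t ≤ T →
    (μ[fun ω => g (x t ω) (ξ t ω) - gradient f (x t ω) | samplesBefore ξ t] =ᵐ[μ] 0) ∧
    ∀ᵐ ω ∂μ, ‖g (x t ω) (ξ t ω) - gradient f (x t ω)‖ ≤ σ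

/-! ### Parameters -/

/-- `log (1/δ)`, but at least `1`. -/
def logFactor (δ : ℝ) : ℝ := max 1 (Real.log (1 / δ))

/-- The quotient `a / b` of nonnegative reals, equal to `∞` when `b = 0 < a`. -/
def extDiv (a b : ℝ) : ℝ≥0∞ := ENNReal.ofReal a / ENNReal.ofReal b

/-- `r = min {1 / (5 L_ρ G^(ρ-1)), 1 / (5 (L₀^(ρ-1) L_ρ)^(1/ρ))}`, where `1/0 = ∞` and the second
entry is left out when `ρ = 0` or `L₀ = 0`. -/
def localRadius (ρ L₀ Lρ G : ℝ) : ℝ≥0∞ :=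
  min (extDiv 1 (5 * Lρ * G ^ (ρ - 1)))
    (if ρ = 0 ∨ L₀ = 0 then ⊤ else extDiv 1 (5 * (L₀ ^ (ρ - 1) * Lρ) ^ (1 / ρ)))

/-- `L = 3 L₀ + 4 L_ρ G^ρ`. -/
def effSmooth (ρ L₀ Lρ G : ℝ) : ℝ := 3 * L₀ + 4 * Lρ * G ^ ρ

/-- The choice of `G`, `β`, `η` for dimension `d`, problem constants `ρ, L₀, L_ρ, σ`,
regularization `lam`, logarithmic factor `ι`, initial gap `Δ₁`, initial gradient norm `n₁`,
accuracy `ε` and numerical constants `c₁, c₂, C₁`. -/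
structure AdamChoice (d : ℕ) (ρ L₀ Lρ lam σ ι Δ₁ n₁ ε c₁ c₂ C₁ G β η : ℝ) : Prop where
  G_pos : 0 < G
  G_ge_lam : 2 * lam ≤ G
  G_ge_sigma : 2 * σ ≤ G
  G_ge_grad : 2 * n₁ ≤ G
  G_ge_L0 : Real.sqrt (C₁ * Δ₁ * L₀ * Real.sqrt d) ≤ G
  G_ge_Lrho : (C₁ * Δ₁ * Lρ * Real.sqrt d) ^ (1 / (2 - ρ)) ≤ G
  beta_pos : 0 < β
  beta_le : ENNReal.ofReal β ≤ min 1 (extDiv (c₁ * lam * ε ^ 2) (σ ^ 2 * G * Real.sqrt ι))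
  eta_pos : 0 < η
  eta_le : ENNReal.ofReal η ≤ ENNReal.ofReal c₂ *
    min (localRadius ρ L₀ Lρ G / ENNReal.ofReal (Real.sqrt d))
      (min (extDiv (lam * β) (Real.sqrt (d * ι) * effSmooth ρ L₀ Lρ G))
        (extDiv (lam ^ (3 / 2 : ℝ) * β) (effSmooth ρ L₀ Lρ G * Real.sqrt G)))

/-- The number of iterations `T = max {1/β², C₂ Δ₁ G / (η ε²)}`, rounded up to an integer. -/
def adamHorizon (Δ₁ ε C₂ G β η : ℝ) : ℕ :=
  ⌈max (1 / β ^ 2) (C₂ * Δ₁ * G / (η * ε ^ 2))⌉₊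

/-- The initial sub-optimality gap `f(x₁) - inf_U f`. -/
def initialGap {d : ℕ} (U : Set (RVec d)) (f : RVec d → ℝ) (x₁ : RVec d) : ℝ :=
  f x₁ - sInf (f '' U)

end

/-! While the gradients stay below `G`, Adam is a descent method with bounded diagonal
preconditioner, and the descent in turn keeps the gradients below `G`; the two facts are proved by
one induction on time along a fixed path (`IsAdamTrajectory.gradient_bounds`).

Bias correction turns both momenta into averages with common weights between `β` and `1`. By Jensen
the averaged gradient is at most the root of the averaged square, so each coordinate moves by at
most `η` and a step by at most `η√d`, which is within the local radius. On such steps the gradient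
is `L`-Lipschitz (`smooth_step`). Coordinate step sizes lie between `η/(2G)` and `η/λ`, so a step
gains a multiple of `(η/G)‖∇f‖²` and loses at most `(η/λ)‖error‖²`. The error of the averaged
gradient is a drift plus the averaged noise. The drift contracts and is driven by gradient changes,
so small `η` absorbs it; what remains is `∑‖∇f‖² ≤ 16GΔ/η + (64G/λ)∑‖noise average‖²`
(`IsAdamTrajectory.sum_sq_gradient_le`).

The gradient norm changes by at most `Lη√d` per step, so climbing from `G/2` to `G` takes many steps
with norm above `G/2`, which costs more square sum than is available (`norm_le_of_sum_sq_le`).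

The noise enters only through its averages. Expanding their squares leaves deterministic terms and a
martingale, which Azuma-Hoeffding controls (`measure_sum_sq_expAverage_gt_le`). Since the noise
bound `σ` does not depend on the gradients, no stopping time is needed: one exceptional event of
probability `δ` is removed and all else is pathwise.

For the complexity, `G` is taken of order `d^(1/(2(2-ρ)))`, and the exponent `p` is what the last
two constraints on `η` require. -/

/-! ### Lipschitz bounds for the gradient from an almost everywhere Hessian bound. -/

section LocalSmoothness

open Set Filter Topology

/-- Mean value inequality when the derivative exists everywhere but is bounded only almost
everywhere. -/
theorem norm_sub_le_of_ae_norm_deriv_le {F : Type*} [NormedAddCommGroup F] [NormedSpace ℝ F]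
    [CompleteSpace F] {φ : ℝ → F} {a b M : ℝ} (hab : a ≤ b)
    (hφ : ∀ s ∈ Icc a b, DifferentiableAt ℝ φ s)
    (hM : ∀ᵐ s ∂(volume : Measure ℝ), s ∈ Icc a b → ‖deriv φ s‖ ≤ M) :
    ‖φ b - φ a‖ ≤ M * (b - a) := by
  have hd : ∀ s ∈ uIcc a b, HasDerivAt φ (deriv φ s) s := fun s hs =>
    (hφ s (by rwa [uIcc_of_le hab] at hs)).hasDerivAt
  have hint : IntervalIntegrable (deriv φ) volume a b := by
    rw [intervalIntegrable_iff_integrableOn_Icc_of_le hab]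
    refine Measure.integrableOn_of_bounded (M := M) (by simp)
      (aestronglyMeasurable_deriv φ volume) ?_
    rw [ae_restrict_iff' measurableSet_Icc]
    exact hM
  -- The derivative exists at every point and is integrable, so the fundamental theorem applies;
  -- existence almost everywhere would not suffice.
  rw [← intervalIntegral.integral_eq_sub_of_hasDerivAt hd hint]
  have := intervalIntegral.norm_integral_le_of_norm_le_const_ae (f := deriv φ) (a := a) (b := b)
    (C := M) (by
      filter_upwards [hM] with s hs hs'
      rw [uIoc_of_le hab] at hs'
      exact hs ⟨hs'.1.le, hs'.2⟩)
  rwa [abs_of_nonneg (sub_nonneg.2 hab)] at this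

/-- A map which is differentiable on an open set `W` with derivative bounded by `M` almost
everywhere is `M`-Lipschitz along every segment inside `W`. -/
theorem norm_sub_le_of_ae_norm_fderiv_le {d : ℕ} {F : RVec d → RVec d} {W : Set (RVec d)}
    {M : ℝ} (hW : IsOpen W) (hF : ∀ x ∈ W, DifferentiableAt ℝ F x)
    (hM : ∀ᵐ x ∂(volume : Measure (RVec d)), x ∈ W → ‖fderiv ℝ F x‖ ≤ M)
    {x y : RVec d} (hxy : segment ℝ x y ⊆ W) : ‖F y - F x‖ ≤ M * ‖y - x‖ := by
  set v := y - x with hv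
  have hline : ∀ s ∈ Icc (0 : ℝ) 1, x + s • v ∈ W := fun s hs =>
    hxy (by rw [segment_eq_image']; exact ⟨s, hs, rfl⟩)
  obtain ⟨S, hS, hSm, hSM⟩ := hM.exists_measurable_mem
  -- A segment may be a null set and miss the good set `S` entirely. By Fubini almost every
  -- translate of it meets `S` at almost every parameter; such translates are dense, and the
  -- estimate passes to the limit `z → x`.
  have hae := (ae_ae_add_linearMap_mem_iff (LinearMap.toSpanSingleton ℝ (RVec d) v)
    (volume : Measure ℝ) (volume : Measure (RVec d)) hSm).2 hS
  have hnear : ∀ᶠ z in 𝓝 x, ∀ s ∈ Icc (0 : ℝ) 1, z + s • v ∈ W := by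
    refine isCompact_Icc.eventually_forall_of_forall_eventually fun s hs => ?_
    have : ContinuousAt (fun p : RVec d × ℝ => p.1 + p.2 • v) (x, s) := by fun_prop
    exact this (hW.mem_nhds (hline s hs))
  have hfreq : ∃ᶠ z in 𝓝 x, ∀ᵐ s ∂(volume : Measure ℝ),
      z + LinearMap.toSpanSingleton ℝ (RVec d) v s ∈ S :=
    mem_closure_iff_frequently.1 (Measure.dense_of_ae hae x)
  have hx : x ∈ W := by simpa using hline 0 (by simp)
  have hy : x + v ∈ W := by simpa using hline 1 (by simp)
  have hcont : Tendsto (fun z => ‖F (z + v) - F z‖) (𝓝 x) (𝓝 ‖F (x + v) - F x‖) := by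
    have h1 : ContinuousAt F (x + v) := (hF _ hy).continuousAt
    have h2 : ContinuousAt (fun z => F (z + v)) x :=
      ContinuousAt.comp (f := fun z => z + v) h1 (by fun_prop)
    exact (h2.sub (hF _ hx).continuousAt).norm
  have hyv : y = x + v := by simp [hv]
  rw [hyv]
  refine le_of_tendsto_of_frequently hcont ((hfreq.and_eventually hnear).mono ?_)
  rintro z ⟨hz, hzW⟩
  have hder : ∀ s ∈ Icc (0 : ℝ) 1, HasDerivAt (fun s : ℝ => F (z + s • v))
      (fderiv ℝ F (z + s • v) v) s := fun s hs => by
    have h1 : HasDerivAt (fun s : ℝ => z + s • v) v s := by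
      simpa using ((hasDerivAt_id s).smul_const v).const_add z
    exact (hF _ (hzW s hs)).hasFDerivAt.comp_hasDerivAt s h1
  have := norm_sub_le_of_ae_norm_deriv_le (φ := fun s : ℝ => F (z + s • v)) (M := M * ‖v‖)
    zero_le_one (fun s hs => (hder s hs).differentiableAt) (by
      filter_upwards [hz] with s hs hs'
      rw [(hder s hs').deriv]
      refine (ContinuousLinearMap.le_opNorm _ _).trans ?_
      gcongr
      exact hSM _ hs (hzW s hs'))
  simpa using this

theorem continuousOn_gradient {d : ℕ} {U : Set (RVec d)} {f : RVec d → ℝ} {ρ L₀ Lρ : ℝ}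
    (hf : IsL0LrhoSmooth U f ρ L₀ Lρ) : ContinuousOn (gradient f) U :=
  fun x hx => (hf.1 x hx).continuousAt.continuousWithinAt

/-- Lipschitz bound for the gradient along a segment on which the gradient is less than `B`. -/
theorem norm_gradient_sub_le_of_lt {d : ℕ} {U : Set (RVec d)} {f : RVec d → ℝ} {ρ L₀ Lρ B : ℝ}
    (hU : IsOpen U) (hf : IsL0LrhoSmooth U f ρ L₀ Lρ) (hρ : 0 ≤ ρ) (hLρ : 0 ≤ Lρ)
    {x y : RVec d} (hxy : segment ℝ x y ⊆ U) (hB : ∀ z ∈ segment ℝ x y, ‖gradient f z‖ < B) :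
    ‖gradient f y - gradient f x‖ ≤ (L₀ + Lρ * B ^ ρ) * ‖y - x‖ := by
  -- The strict inequality makes the sublevel set open, so nearby translates of the segment stay in
  -- it.
  have hW : IsOpen (U ∩ (fun z => ‖gradient f z‖) ⁻¹' Iio B) :=
    (continuousOn_gradient hf).norm.isOpen_inter_preimage hU isOpen_Iio
  refine norm_sub_le_of_ae_norm_fderiv_le hW (fun z hz => hf.1 z hz.1) ?_
    (fun z hz => ⟨hxy hz, hB z hz⟩)
  filter_upwards [hf.2] with z hz hzW
  refine (hz hzW.1).trans ?_
  gcongr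
  exact (mem_preimage.1 hzW.2).le

/-- The gradient cannot leave the ball of radius `G + a` along a segment which is too short for
it. -/
theorem norm_gradient_sub_le {d : ℕ} {U : Set (RVec d)} {f : RVec d → ℝ} {ρ L₀ Lρ G a : ℝ}
    (hU : IsOpen U) (hf : IsL0LrhoSmooth U f ρ L₀ Lρ) (hρ : 0 ≤ ρ) (hL₀ : 0 ≤ L₀) (hLρ : 0 ≤ Lρ)
    (hG : 0 ≤ G) (ha : 0 < a)
    {x y : RVec d} (hxy : segment ℝ x y ⊆ U) (hx : ‖gradient f x‖ ≤ G)
    (hshort : (L₀ + Lρ * (G + a) ^ ρ) * ‖y - x‖ < a) :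
    ‖gradient f y - gradient f x‖ ≤ (L₀ + Lρ * (G + a) ^ ρ) * ‖y - x‖ := by
  set ℓ := L₀ + Lρ * (G + a) ^ ρ with hℓ
  have hℓ0 : 0 ≤ ℓ := by positivity
  set p : ℝ → RVec d := fun s => x + s • (y - x) with hp
  have hpc : Continuous p := by fun_prop
  have hpU : ∀ s ∈ Icc (0 : ℝ) 1, p s ∈ U := fun s hs =>
    hxy (by rw [segment_eq_image']; exact ⟨s, hs, rfl⟩)
  have hgc : ContinuousOn (fun s => gradient f (p s)) (Icc 0 1) :=
    (continuousOn_gradient hf).comp hpc.continuousOn hpU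
  have hseg : ∀ s ∈ Icc (0 : ℝ) 1, ∀ z ∈ segment ℝ x (p s), ∃ r ∈ Icc (0 : ℝ) s, z = p r := by
    intro s hs z hz
    rw [segment_eq_image'] at hz
    obtain ⟨r, hr, rfl⟩ := hz
    refine ⟨r * s, ⟨mul_nonneg hr.1 hs.1, mul_le_of_le_one_left hs.1 hr.2⟩, ?_⟩
    simp [hp, smul_smul]
  have hstep : ∀ s ∈ Icc (0 : ℝ) 1, (∀ r ∈ Icc (0 : ℝ) s, ‖gradient f (p r)‖ < G + a) →
      ‖gradient f (p s) - gradient f x‖ ≤ ℓ * (s * ‖y - x‖) := by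
    intro s hs hr
    have := norm_gradient_sub_le_of_lt (x := x) (y := p s) hU hf hρ hLρ (B := G + a)
      (fun z hz => by
        obtain ⟨r, hr, rfl⟩ := hseg s hs z hz
        exact hpU r ⟨hr.1, hr.2.trans hs.2⟩)
      (fun z hz => by
        obtain ⟨r, hr', rfl⟩ := hseg s hs z hz
        exact hr r hr')
    have e : ‖p s - x‖ = s * ‖y - x‖ := by
      simp [hp, norm_smul, abs_of_nonneg hs.1]
    rwa [e] at this
  -- First exit: up to the least `s₀` with norm at least `G + a` the Lipschitz bound holds, and in
  -- the limit it gives `G + ℓ‖y - x‖ < G + a` at `s₀`.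
  have hlt : ∀ s ∈ Icc (0 : ℝ) 1, ‖gradient f (p s)‖ < G + a := by
    by_contra! hcon
    have hA : IsCompact (Icc (0 : ℝ) 1 ∩ (fun s => ‖gradient f (p s)‖) ⁻¹' Ici (G + a)) :=
      (hgc.norm.preimage_isClosed_of_isClosed isClosed_Icc isClosed_Ici |> fun h =>
        isCompact_Icc.of_isClosed_subset h inter_subset_left)
    obtain ⟨s₁, hs₁, hs₁'⟩ := hcon
    obtain ⟨s₀, ⟨hs₀, hs₀'⟩, hmin⟩ := hA.exists_isLeast ⟨s₁, hs₁, hs₁'⟩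
    have hbelow : ∀ r ∈ Ico (0 : ℝ) s₀, ‖gradient f (p r)‖ < G + a := fun r hr => by
      by_contra! h
      exact absurd (hmin ⟨⟨hr.1, hr.2.le.trans hs₀.2⟩, h⟩) (not_le.2 hr.2)
    have hs₀pos : 0 < s₀ := by
      rcases hs₀.1.eq_or_lt with h | h
      · have h3 : G + a ≤ ‖gradient f (p s₀)‖ := hs₀'
        rw [← h] at h3
        simp [hp] at h3
        linarith
      · exact h
    have hbound : ∀ r ∈ Ico (0 : ℝ) s₀, ‖gradient f (p r)‖ ≤ G + ℓ * ‖y - x‖ := fun r hr => by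
      have h1 := hstep r ⟨hr.1, hr.2.le.trans hs₀.2⟩ fun r' hr' =>
        hbelow r' ⟨hr'.1, hr'.2.trans_lt hr.2⟩
      have h2 : ℓ * (r * ‖y - x‖) ≤ ℓ * ‖y - x‖ := by
        gcongr
        exact mul_le_of_le_one_left (norm_nonneg _) (hr.2.le.trans hs₀.2)
      have h3 := norm_sub_norm_le (gradient f (p r)) (gradient f x)
      linarith
    have hlim : Tendsto (fun r => ‖gradient f (p r)‖) (𝓝[Ico 0 s₀] s₀)
        (𝓝 ‖gradient f (p s₀)‖) :=
      ((hgc s₀ hs₀).norm).mono_left (nhdsWithin_mono _ fun r hr => ⟨hr.1, hr.2.le.trans hs₀.2⟩)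
    have hne : (𝓝[Ico 0 s₀] s₀).NeBot := by
      rw [← mem_closure_iff_nhdsWithin_neBot, closure_Ico hs₀pos.ne]
      exact ⟨hs₀pos.le, le_rfl⟩
    have := le_of_tendsto hlim (eventually_mem_nhdsWithin.mono hbound)
    have h3 : G + a ≤ ‖gradient f (p s₀)‖ := hs₀'
    linarith
  have h1 := hstep 1 (by simp) hlt
  simpa [hp] using h1

end LocalSmoothness

/-! ### The local radius and the descent inequality. -/

section LocalRadius

theorem rpow_add_le_two_mul {x y ρ : ℝ} (hx : 0 ≤ x) (hy : 0 ≤ y) (hρ : 0 ≤ ρ) (hρ2 : ρ < 2) :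
    (x + y) ^ ρ ≤ 2 * (x ^ ρ + y ^ ρ) := by
  lift x to NNReal using hx
  lift y to NNReal using hy
  have h0 : 0 ≤ (x : ℝ) ^ ρ + (y : ℝ) ^ ρ := by positivity
  rcases le_total ρ 1 with h | h
  · have h1 : ((x : ℝ) + y) ^ ρ ≤ (x : ℝ) ^ ρ + (y : ℝ) ^ ρ := by
      exact_mod_cast NNReal.rpow_add_le_add_rpow x y hρ h
    linarith
  · have h1 : ((x : ℝ) + y) ^ ρ ≤ (2 : ℝ) ^ (ρ - 1) * ((x : ℝ) ^ ρ + (y : ℝ) ^ ρ) := by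
      exact_mod_cast NNReal.rpow_add_le_mul_rpow_add_rpow x y h
    refine h1.trans ?_
    gcongr
    calc (2 : ℝ) ^ (ρ - 1) ≤ 2 ^ (1 : ℝ) :=
          Real.rpow_le_rpow_of_exponent_le (by norm_num) (by linarith)
      _ = 2 := Real.rpow_one 2

/-- Steps shorter than half the local radius leave room for the growth of the gradient. -/
theorem exists_gradient_slack {ρ L₀ Lρ G w : ℝ} (hρ : 0 ≤ ρ) (hρ2 : ρ < 2) (hL₀ : 0 ≤ L₀)
    (hLρ : 0 ≤ Lρ) (hG : 0 < G) (hw : 0 ≤ w)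
    (h1 : w * (5 * Lρ * G ^ (ρ - 1)) ≤ 1 / 2)
    (h2 : ρ ≠ 0 → L₀ ≠ 0 → w * (5 * (L₀ ^ (ρ - 1) * Lρ) ^ (1 / ρ)) ≤ 1 / 2) :
    ∃ a : ℝ, 0 < a ∧ (L₀ + Lρ * (G + a) ^ ρ) * w < a ∧
      L₀ + Lρ * (G + a) ^ ρ ≤ effSmooth ρ L₀ Lρ G := by
  unfold effSmooth
  rcases hρ.eq_or_lt with rfl | hρ0
  · refine ⟨(L₀ + Lρ) * w + 1, by positivity, by simp, ?_⟩
    simp only [Real.rpow_zero]; linarith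
  rcases hLρ.eq_or_lt with rfl | hLρ0
  · exact ⟨L₀ * w + 1, by positivity, by simp, by simp; linarith⟩
  have hGG : Lρ * G ^ ρ * w ≤ G / 10 := by
    have e : G ^ ρ = G ^ (ρ - 1) * G := by
      rw [← Real.rpow_add_one hG.ne']; congr 1; ring
    rw [e]
    nlinarith
  have hGρ : 0 < G ^ ρ := by positivity
  -- Slack `a = G`: the growth is at most `G/10 + 4G/10 < G`. The `4` in `effSmooth` arises here.
  have key : L₀ * w ≤ G / 10 → ∃ a : ℝ, 0 < a ∧ (L₀ + Lρ * (G + a) ^ ρ) * w < a ∧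
      L₀ + Lρ * (G + a) ^ ρ ≤ 3 * L₀ + 4 * Lρ * G ^ ρ := by
    intro hL
    have h3 := rpow_add_le_two_mul hG.le hG.le hρ hρ2
    have h4 : Lρ * (G + G) ^ ρ ≤ 4 * (Lρ * G ^ ρ) := by nlinarith
    refine ⟨G, hG, ?_, by linarith⟩
    have : Lρ * (G + G) ^ ρ * w ≤ 4 * (Lρ * G ^ ρ) * w := by gcongr
    nlinarith
  rcases hL₀.eq_or_lt with rfl | hL₀0
  · exact key (by simp; positivity)
  -- The gradient norm at which the two terms of the Hessian bound balance. The second entry of the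
  -- radius equals `G₀ / (5 L₀)`. The slack is the larger of `G` and `G₀`; the choice `G₀` produces
  -- the `3 L₀` in `effSmooth`.
  set G₀ : ℝ := (L₀ / Lρ) ^ (1 / ρ) with hG₀
  have hG₀0 : 0 < G₀ := by positivity
  have hG₀ρ : Lρ * G₀ ^ ρ = L₀ := by
    rw [hG₀, ← Real.rpow_mul (by positivity), one_div_mul_cancel hρ0.ne', Real.rpow_one]
    field_simp
  have hprod : (L₀ ^ (ρ - 1) * Lρ) ^ (1 / ρ) * G₀ = L₀ := by
    rw [hG₀, ← Real.mul_rpow (by positivity) (by positivity)]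
    have : L₀ ^ (ρ - 1) * Lρ * (L₀ / Lρ) = L₀ ^ ρ := by
      rw [show L₀ ^ ρ = L₀ ^ (ρ - 1) * L₀ by
        rw [← Real.rpow_add_one hL₀0.ne']; congr 1; ring]
      field_simp
    rw [this, ← Real.rpow_mul hL₀, mul_one_div_cancel hρ0.ne', Real.rpow_one]
  have hLw : L₀ * w ≤ G₀ / 10 := by
    have := mul_le_mul_of_nonneg_right (h2 hρ0.ne' hL₀0.ne') hG₀0.le
    nlinarith
  rcases le_total G₀ G with h | h
  · exact key (by linarith)
  · have h3 := rpow_add_le_two_mul hG.le hG₀0.le hρ hρ2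
    have h4 : Lρ * (G + G₀) ^ ρ ≤ 2 * (Lρ * G ^ ρ) + 2 * L₀ := by
      rw [← hG₀ρ] ; nlinarith
    have h5 : Lρ * G ^ ρ ≤ L₀ := by
      rw [← hG₀ρ]; gcongr
    refine ⟨G₀, hG₀0, ?_, by nlinarith⟩
    have : (L₀ + Lρ * (G + G₀) ^ ρ) * w ≤ (5 * L₀) * w := by
      gcongr; linarith
    nlinarith

/-- First and second order bounds for a step of length at most `w`. -/
theorem smooth_step {d : ℕ} {U : Set (RVec d)} {f : RVec d → ℝ} {ρ L₀ Lρ G w : ℝ}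
    (hU : IsOpen U) (hfd : ∀ x ∈ U, DifferentiableAt ℝ f x) (hf : IsL0LrhoSmooth U f ρ L₀ Lρ)
    (hρ : 0 ≤ ρ) (hρ2 : ρ < 2) (hL₀ : 0 ≤ L₀) (hLρ : 0 ≤ Lρ) (hG : 0 < G)
    (h1 : w * (5 * Lρ * G ^ (ρ - 1)) ≤ 1 / 2)
    (h2 : ρ ≠ 0 → L₀ ≠ 0 → w * (5 * (L₀ ^ (ρ - 1) * Lρ) ^ (1 / ρ)) ≤ 1 / 2)
    {x y : RVec d} (hxy : segment ℝ x y ⊆ U) (hx : ‖gradient f x‖ ≤ G) (hw : ‖y - x‖ ≤ w) :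
    ‖gradient f y - gradient f x‖ ≤ effSmooth ρ L₀ Lρ G * ‖y - x‖ ∧
      f y - f x ≤ inner ℝ (gradient f x) (y - x) + effSmooth ρ L₀ Lρ G * ‖y - x‖ ^ 2 := by
  have hw0 : 0 ≤ w := (norm_nonneg _).trans hw
  obtain ⟨a, ha, hshort, hL⟩ := exists_gradient_slack hρ hρ2 hL₀ hLρ hG hw0 h1 h2
  set L := effSmooth ρ L₀ Lρ G
  have hℓ0 : 0 ≤ L₀ + Lρ * (G + a) ^ ρ := by positivity
  have hall : ∀ z ∈ segment ℝ x y, ‖gradient f z - gradient f x‖ ≤ L * ‖y - x‖ := by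
    intro z hz
    have hzx : ‖z - x‖ ≤ ‖y - x‖ := by
      rw [segment_eq_image'] at hz
      obtain ⟨s, hs, rfl⟩ := hz
      simp only [add_sub_cancel_left, norm_smul, Real.norm_eq_abs, abs_of_nonneg hs.1]
      exact mul_le_of_le_one_left (norm_nonneg _) hs.2
    have hsub : segment ℝ x z ⊆ U :=
      ((convex_segment x y).segment_subset (left_mem_segment ℝ x y) hz).trans hxy
    have := norm_gradient_sub_le hU hf hρ hL₀ hLρ hG.le ha hsub hx
      (lt_of_le_of_lt (by gcongr; exact hzx.trans hw) hshort)
    refine this.trans ?_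
    gcongr
    exact hℓ0.trans hL
  refine ⟨hall y (right_mem_segment ℝ x y), ?_⟩
  -- The mean value theorem in place of an integral costs the factor `1/2` of the usual descent
  -- lemma.
  obtain ⟨z, hz, he⟩ := domain_mvt (s := segment ℝ x y)
    (f' := fun z => InnerProductSpace.toDual ℝ (RVec d) (gradient f z))
    (fun z hz => ((hfd z (hxy hz)).hasGradientAt.hasFDerivAt).hasFDerivWithinAt)
    (convex_segment x y) (left_mem_segment ℝ x y) (right_mem_segment ℝ x y)
  rw [he, InnerProductSpace.toDual_apply_apply]
  have h3 : inner ℝ (gradient f z) (y - x) =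
      inner ℝ (gradient f x) (y - x) + inner ℝ (gradient f z - gradient f x) (y - x) := by
    rw [← inner_add_left]; congr 1; abel
  have h4 := real_inner_le_norm (gradient f z - gradient f x) (y - x)
  have h5 := mul_le_mul_of_nonneg_right (hall z hz) (norm_nonneg (y - x))
  rw [h3]
  nlinarith

end LocalRadius

/-! ### Exponential averages with variable weights. -/

section ExponentialAverage

/-- The averages `e₀ = u₀`, `eₖ₊₁ = (1 - αₖ₊₁) eₖ + αₖ₊₁ uₖ₊₁`. -/
def expAverage {E : Type*} [AddCommGroup E] [Module ℝ E] (α : ℕ → ℝ) (u : ℕ → E) : ℕ → E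
  | 0 => u 0
  | k + 1 => (1 - α (k + 1)) • expAverage α u k + α (k + 1) • u (k + 1)

theorem expAverage_apply {d : ℕ} (α : ℕ → ℝ) (u : ℕ → RVec d) (k : ℕ) (i : Fin d) :
    expAverage α u k i = expAverage α (fun j => u j i) k := by
  induction k with
  | zero => rfl
  | succ k ih => simp [expAverage, ih]

theorem norm_expAverage_le {E : Type*} [NormedAddCommGroup E] [NormedSpace ℝ E] {α : ℕ → ℝ}
    {u : ℕ → E} {c : ℝ} (hα0 : ∀ k, 0 ≤ α k) (hα1 : ∀ k, α k ≤ 1) {k : ℕ}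
    (hu : ∀ j ≤ k, ‖u j‖ ≤ c) : ‖expAverage α u k‖ ≤ c := by
  induction k with
  | zero => exact hu 0 le_rfl
  | succ k ih =>
    have h1 := ih fun j hj => hu j (hj.trans k.le_succ)
    have h2 := hu (k + 1) le_rfl
    refine (norm_add_le _ _).trans ?_
    rw [norm_smul, norm_smul, Real.norm_of_nonneg (sub_nonneg.2 (hα1 _)),
      Real.norm_of_nonneg (hα0 _)]
    nlinarith [hα0 (k + 1), hα1 (k + 1)]

/-- Jensen for a convex combination. In Adam it compares first and second momentum, which requires
equal weights, that is `β_sq = β`. -/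
theorem sq_expAverage_le {α : ℕ → ℝ} {u : ℕ → ℝ} (hα0 : ∀ k, 0 ≤ α k) (hα1 : ∀ k, α k ≤ 1)
    (k : ℕ) : expAverage α u k ^ 2 ≤ expAverage α (fun j => u j ^ 2) k := by
  induction k with
  | zero => exact le_rfl
  | succ k ih =>
    simp only [expAverage, smul_eq_mul]
    have h0 := hα0 (k + 1)
    have h1 := sub_nonneg.2 (hα1 (k + 1))
    have h2 := mul_le_mul_of_nonneg_left ih h1
    nlinarith [mul_nonneg (mul_nonneg h0 h1) (sq_nonneg (expAverage α u k - u (k + 1)))]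

/-- A contraction with factors `1 - αₖ`, `αₖ ≥ β`, perturbed by `wₖ`, is summable in square. -/
theorem sum_sq_norm_contraction_le {E : Type*} [NormedAddCommGroup E] [NormedSpace ℝ E]
    {α : ℕ → ℝ} {β : ℝ} {D w : ℕ → E} (hβ : 0 < β) (hαβ : ∀ k, β ≤ α k) (hα1 : ∀ k, α k ≤ 1)
    (hD0 : D 0 = 0) (hD : ∀ k, D (k + 1) = (1 - α (k + 1)) • (D k + w k)) (t : ℕ) :
    β ^ 2 * ∑ k ∈ Finset.range t, ‖D k‖ ^ 2 ≤ ∑ k ∈ Finset.range (t - 1), ‖w k‖ ^ 2 := by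
  have hβ1 : β ≤ 1 := (hαβ 0).trans (hα1 0)
  -- Young's inequality with weights chosen so that one factor `1 - β` survives in front of `‖D k‖ ^
  -- 2`.
  have hstep : ∀ k, β * ‖D (k + 1)‖ ^ 2 ≤ β * (1 - β) * ‖D k‖ ^ 2 + ‖w k‖ ^ 2 := by
    intro k
    set a := α (k + 1) with ha
    have h1 : β ≤ a := hαβ _
    have h2 : a ≤ 1 := hα1 _
    have h3 : ‖D (k + 1)‖ ≤ (1 - β) * (‖D k‖ + ‖w k‖) := by
      rw [hD, norm_smul, Real.norm_of_nonneg (by linarith)]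
      refine mul_le_mul (by linarith) (norm_add_le _ _) (norm_nonneg _) (by linarith)
    have h4 : ‖D (k + 1)‖ ^ 2 ≤ ((1 - β) * (‖D k‖ + ‖w k‖)) ^ 2 := by gcongr
    have h5 : β * ‖D (k + 1)‖ ^ 2 ≤ β * ((1 - β) * (‖D k‖ + ‖w k‖)) ^ 2 := by gcongr
    refine h5.trans ?_
    have h6 : 0 ≤ 1 - β := by linarith
    nlinarith [mul_nonneg h6 (sq_nonneg (β * ‖D k‖ - (1 - β) * ‖w k‖)),
      mul_nonneg hβ.le (sq_nonneg ‖w k‖), mul_nonneg h6 (sq_nonneg ‖w k‖),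
      mul_nonneg (mul_nonneg hβ.le h6) (sq_nonneg ‖w k‖)]
  -- The boundary term `β(1 - β)‖D t‖²` is exactly what the next step consumes.
  have hsum : ∀ t, β ^ 2 * ∑ k ∈ Finset.range (t + 1), ‖D k‖ ^ 2 +
      β * (1 - β) * ‖D t‖ ^ 2 ≤ ∑ k ∈ Finset.range t, ‖w k‖ ^ 2 := by
    intro t
    induction t with
    | zero => simp [hD0]
    | succ t ih =>
      rw [Finset.sum_range_succ (fun k => ‖D k‖ ^ 2) (t + 1),
        Finset.sum_range_succ (fun k => ‖w k‖ ^ 2) t]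
      nlinarith [hstep t]
  cases t with
  | zero => simp
  | succ t =>
    have h7 := hsum t
    have : 0 ≤ β * (1 - β) * ‖D t‖ ^ 2 :=
      mul_nonneg (mul_nonneg hβ.le (by linarith)) (sq_nonneg _)
    simp only [Nat.add_sub_cancel]
    linarith

end ExponentialAverage

/-! ### One step of Adam: length and descent. -/

section Trajectory

/-- With `L h ≤ 1/8` the claim reduces to `-am + m²/8 ≤ -a²/4 + (m - a)²`, multiplied by the step
size `h`; then `h` is bounded below in the gain and above in the error. -/
theorem scaled_descent_coord {h h₀ h₁ L a m : ℝ} (h0 : 0 ≤ h₀) (hl : h₀ ≤ h) (hu : h ≤ h₁)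
    (hL : 0 ≤ L) (hLh : L * h₁ ≤ 1 / 8) :
    a * (-(h * m)) + L * (h * m) ^ 2 ≤ -(h₀ / 4) * a ^ 2 + h₁ * (m - a) ^ 2 := by
  have hh : 0 ≤ h := h0.trans hl
  have h1 : L * h ≤ 1 / 8 := (mul_le_mul_of_nonneg_left hu hL).trans hLh
  have h2 : L * (h * m) ^ 2 ≤ h * (1 / 8 * m ^ 2) := by
    have := mul_le_mul_of_nonneg_right h1 (mul_nonneg hh (sq_nonneg m))
    nlinarith
  have h3 : a * (-(h * m)) + h * (1 / 8 * m ^ 2) ≤ h * (-(1 / 4) * a ^ 2 + (m - a) ^ 2) := by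
    have : -(a * m) + 1 / 8 * m ^ 2 ≤ -(1 / 4) * a ^ 2 + (m - a) ^ 2 := by
      nlinarith [sq_nonneg (3 * a - 2 * m), sq_nonneg m]
    nlinarith
  have h4 : h₀ * a ^ 2 ≤ h * a ^ 2 := by gcongr
  have h5 : h * (m - a) ^ 2 ≤ h₁ * (m - a) ^ 2 := by gcongr
  nlinarith

/-- `y` is a trajectory of Adam with averaging weights `α` and stochastic gradients `g`. -/
structure IsAdamTrajectory {d : ℕ} (α : ℕ → ℝ) (η lam : ℝ) (g y : ℕ → RVec d) : Prop where
  step : ∀ k i, y (k + 1) i - y k i =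
    -(η / (Real.sqrt (expAverage α (fun j => g j i ^ 2) k) + lam) * expAverage α g k i)

namespace IsAdamTrajectory

variable {d : ℕ} {α : ℕ → ℝ} {η lam : ℝ} {g y : ℕ → RVec d}

/-- The normalization makes each coordinate move at most `η`, whatever the size of the gradients. -/
theorem norm_step_le_sqrt (h : IsAdamTrajectory α η lam g y) (hα0 : ∀ k, 0 ≤ α k)
    (hα1 : ∀ k, α k ≤ 1) (hη : 0 ≤ η) (hlam : 0 < lam) (k : ℕ) :
    ‖y (k + 1) - y k‖ ≤ η * Real.sqrt d := by
  have hc : ∀ i, (y (k + 1) - y k) i ^ 2 ≤ η ^ 2 := by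
    intro i
    rw [PiLp.sub_apply, h.step, expAverage_apply]
    set v := expAverage α (fun j => g j i ^ 2) k
    set m := expAverage α (fun j => g j i) k
    have h1 : m ^ 2 ≤ v := sq_expAverage_le hα0 hα1 k
    have h2 : |m| ≤ Real.sqrt v := Real.abs_le_sqrt h1
    have h3 : 0 < Real.sqrt v + lam := by positivity
    rw [neg_sq, div_mul_eq_mul_div, ← sq_abs, abs_div, abs_mul, abs_of_nonneg hη,
      abs_of_pos h3]
    gcongr
    rw [div_le_iff₀ h3]
    gcongr
    linarith
  rw [EuclideanSpace.norm_eq, Real.sqrt_le_left (by positivity), mul_pow,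
    Real.sq_sqrt (Nat.cast_nonneg d)]
  calc ∑ i, ‖(y (k + 1) - y k) i‖ ^ 2 ≤ ∑ _i : Fin d, η ^ 2 :=
        Finset.sum_le_sum fun i _ => by rw [Real.norm_eq_abs, sq_abs]; exact hc i
    _ = η ^ 2 * d := by simp; ring

/-- Unlike the bound by `η√d`, this one is proportional to the averaged gradient, so that drift
terms can be absorbed into the gradient sum. -/
theorem norm_sq_step_le (h : IsAdamTrajectory α η lam g y) (hη : 0 ≤ η) (hlam : 0 < lam)
    (k : ℕ) : ‖y (k + 1) - y k‖ ^ 2 ≤ (η / lam) ^ 2 * ‖expAverage α g k‖ ^ 2 := by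
  rw [EuclideanSpace.norm_sq_eq, EuclideanSpace.norm_sq_eq, Finset.mul_sum]
  refine Finset.sum_le_sum fun i _ => ?_
  rw [PiLp.sub_apply, h.step, norm_neg, norm_mul, mul_pow]
  have h0 : 0 ≤ Real.sqrt (expAverage α (fun j => g j i ^ 2) k) := Real.sqrt_nonneg _
  rw [Real.norm_of_nonneg (by positivity)]
  gcongr
  linarith

/-- One step of Adam decreases the objective up to the error of the gradient estimate. -/
theorem descent (h : IsAdamTrajectory α η lam g y) (hα0 : ∀ k, 0 ≤ α k)
    (hα1 : ∀ k, α k ≤ 1) (hη : 0 ≤ η) (hlam : 0 < lam) {G L : ℝ} (hG : 2 * lam ≤ G) (hL : 0 ≤ L)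
    (hLη : L * (η / lam) ≤ 1 / 8) {k : ℕ} (hg : ∀ j ≤ k, ‖g j‖ ≤ 3 / 2 * G) (A : RVec d)
    {Δ : ℝ} (hΔ : Δ ≤ inner ℝ A (y (k + 1) - y k) + L * ‖y (k + 1) - y k‖ ^ 2) :
    Δ ≤ -(η / (8 * G)) * ‖A‖ ^ 2 + η / lam * ‖expAverage α g k - A‖ ^ 2 := by
  have hG0 : 0 < G := by linarith
  refine hΔ.trans ?_
  rw [EuclideanSpace.norm_sq_eq, EuclideanSpace.norm_sq_eq, EuclideanSpace.norm_sq_eq,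
    PiLp.inner_apply, Finset.mul_sum, Finset.mul_sum, Finset.mul_sum, ← Finset.sum_add_distrib,
    ← Finset.sum_add_distrib]
  refine Finset.sum_le_sum fun i _ => ?_
  simp only [PiLp.sub_apply, Real.norm_eq_abs, sq_abs]
  rw [h.step]
  set v := expAverage α (fun j => g j i ^ 2) k with hv
  have hv1 : |v| ≤ (3 / 2 * G) ^ 2 := norm_expAverage_le (u := fun j => g j i ^ 2)
      hα0 hα1 fun j hj => by
    have h1 : |g j i| ≤ 3 / 2 * G := (PiLp.norm_apply_le (g j) i).trans (hg j hj)
    rw [Real.norm_of_nonneg (sq_nonneg _)]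
    exact sq_le_sq' (abs_le.1 h1).1 (abs_le.1 h1).2
  have hv2 : Real.sqrt v ≤ 3 / 2 * G :=
    Real.sqrt_le_iff.2 ⟨by positivity, (le_abs_self v).trans hv1⟩
  have hv0 := Real.sqrt_nonneg v
  -- Since `2λ ≤ G`, the denominator is at most `3G/2 + G/2 = 2G`.
  have key := scaled_descent_coord (h := η / (Real.sqrt v + lam)) (h₀ := η / (2 * G))
    (h₁ := η / lam) (L := L) (a := A i) (m := expAverage α g k i) (by positivity)
    (by gcongr; linarith) (by gcongr; linarith) hL hLη
  have e : η / (2 * G) / 4 = η / (8 * G) := by field_simp; ring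
  rw [e] at key
  have e2 : inner ℝ (A i) (-(η / (Real.sqrt v + lam) * expAverage α g k i)) =
      A i * (-(η / (Real.sqrt v + lam) * expAverage α g k i)) := by
    rw [real_inner_comm]; rfl
  rw [e2, neg_sq]
  exact key

end IsAdamTrajectory

end Trajectory

/-! ### Bounds along a whole path. -/

section TrajectoryBounds

/-- Bound on the gradient sum while the gradients stay below `G`, in terms of the decrease of the
objective and of the averaged noise. -/
theorem IsAdamTrajectory.sum_sq_gradient_le {d : ℕ} {α : ℕ → ℝ} {η lam β G L σ : ℝ}
    {A n y : ℕ → RVec d} {F : ℕ → ℝ}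
    (h : IsAdamTrajectory α η lam (fun k => A k + n k) y)
    (hβ : 0 < β) (hαβ : ∀ k, β ≤ α k) (hα1 : ∀ k, α k ≤ 1) (hη : 0 < η) (hlam : 0 < lam)
    (hG : 2 * lam ≤ G) (hσG : 2 * σ ≤ G) (hL : 0 ≤ L)
    (hLη : L * η ≤ lam * β / 16) (hLη2 : (L * η) ^ 2 * G ≤ lam ^ 3 * β ^ 2 / 128)
    {t : ℕ} (hn : ∀ k < t, ‖n k‖ ≤ σ) (hA : ∀ k < t, ‖A k‖ ≤ G)
    (hlip : ∀ k < t, ‖A (k + 1) - A k‖ ≤ L * ‖y (k + 1) - y k‖)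
    (hdesc : ∀ k < t, F (k + 1) - F k ≤
      inner ℝ (A k) (y (k + 1) - y k) + L * ‖y (k + 1) - y k‖ ^ 2) :
    ∑ k ∈ Finset.range t, ‖A k‖ ^ 2 ≤ 16 * G * (F 0 - F t) / η +
      64 * G / lam * ∑ k ∈ Finset.range t, ‖expAverage α n k‖ ^ 2 := by
  have hβ1 : β ≤ 1 := (hαβ 0).trans (hα1 0)
  have hα0 : ∀ k, 0 ≤ α k := fun k => hβ.le.trans (hαβ k)
  have hG0 : 0 < G := by linarith
  set M : ℕ → RVec d := expAverage α fun k => A k + n k with hM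
  set N : ℕ → RVec d := expAverage α n with hN
  -- The drift: averaging is linear, so the noise splits off. `D 0 = 0` because the average starts
  -- at its first entry, and `D (k+1) = (1 - α)(D k + A k - A (k+1))`.
  set D : ℕ → RVec d := fun k => M k - A k - N k with hD
  set S := ∑ k ∈ Finset.range t, ‖A k‖ ^ 2 with hS
  set E := ∑ k ∈ Finset.range t, ‖M k - A k‖ ^ 2 with hE
  set NN := ∑ k ∈ Finset.range t, ‖N k‖ ^ 2 with hNN
  set DD := ∑ k ∈ Finset.range t, ‖D k‖ ^ 2 with hDD
  have hS0 : 0 ≤ S := Finset.sum_nonneg fun _ _ => sq_nonneg _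
  have hE0 : 0 ≤ E := Finset.sum_nonneg fun _ _ => sq_nonneg _
  have hNN0 : 0 ≤ NN := Finset.sum_nonneg fun _ _ => sq_nonneg _
  -- descent
  have h1 : η / (8 * G) * S ≤ F 0 - F t + η / lam * E := by
    have hLl : L * (η / lam) ≤ 1 / 8 := by
      rw [← mul_div_assoc, div_le_iff₀ hlam]
      nlinarith
    have hk : ∀ k ∈ Finset.range t, F (k + 1) - F k ≤
        -(η / (8 * G)) * ‖A k‖ ^ 2 + η / lam * ‖M k - A k‖ ^ 2 := by
      intro k hk
      have hk' := Finset.mem_range.1 hk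
      refine h.descent hα0 hα1 hη.le hlam hG hL hLl (fun j hj => ?_) (A k) (hdesc k hk')
      have := norm_add_le (A j) (n j)
      have := hA j (hj.trans_lt hk')
      have := hn j (hj.trans_lt hk')
      linarith
    have := Finset.sum_le_sum hk
    rw [Finset.sum_range_sub, Finset.sum_add_distrib, ← Finset.mul_sum, ← Finset.mul_sum] at this
    linarith
  -- splitting the error
  have h2 : E ≤ 2 * DD + 2 * NN := by
    rw [hDD, hNN, Finset.mul_sum, Finset.mul_sum, ← Finset.sum_add_distrib]
    refine Finset.sum_le_sum fun k _ => ?_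
    have e : M k - A k = D k + N k := by simp [hD]
    have h3 := norm_add_le (D k) (N k)
    rw [e]
    have h4 : ‖D k + N k‖ ^ 2 ≤ (‖D k‖ + ‖N k‖) ^ 2 := by gcongr
    nlinarith [sq_nonneg (‖D k‖ - ‖N k‖)]
  have h3 : β ^ 2 * DD ≤ 2 * (L * (η / lam)) ^ 2 * (S + E) := by
    have hrec := sum_sq_norm_contraction_le (D := D) (w := fun k => A k - A (k + 1)) hβ hαβ hα1
      (by simp [hD, hM, hN, expAverage])
      (fun k => by simp only [hD, hM, hN, expAverage]; module) t
    refine hrec.trans ?_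
    have hle : ∀ k ∈ Finset.range t, ‖A k - A (k + 1)‖ ^ 2 ≤
        2 * (L * (η / lam)) ^ 2 * (‖A k‖ ^ 2 + ‖M k - A k‖ ^ 2) := by
      intro k hk
      have h4 := hlip k (Finset.mem_range.1 hk)
      rw [norm_sub_rev] at h4
      have h5 := h.norm_sq_step_le hη.le hlam k
      have h6 : ‖M k‖ ^ 2 ≤ 2 * (‖A k‖ ^ 2 + ‖M k - A k‖ ^ 2) := by
        have h7 := norm_add_le (A k) (M k - A k)
        rw [add_sub_cancel] at h7
        have h8 : ‖M k‖ ^ 2 ≤ (‖A k‖ + ‖M k - A k‖) ^ 2 := by gcongr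
        nlinarith [sq_nonneg (‖A k‖ - ‖M k - A k‖)]
      calc ‖A k - A (k + 1)‖ ^ 2 ≤ (L * ‖y (k + 1) - y k‖) ^ 2 := by gcongr
        _ = L ^ 2 * ‖y (k + 1) - y k‖ ^ 2 := by ring
        _ ≤ L ^ 2 * ((η / lam) ^ 2 * (2 * (‖A k‖ ^ 2 + ‖M k - A k‖ ^ 2))) := by
            gcongr
            exact h5.trans (by gcongr)
        _ = _ := by ring
    calc ∑ k ∈ Finset.range (t - 1), ‖A k - A (k + 1)‖ ^ 2
        ≤ ∑ k ∈ Finset.range t, ‖A k - A (k + 1)‖ ^ 2 :=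
          Finset.sum_le_sum_of_subset_of_nonneg
            (Finset.range_mono (Nat.sub_le t 1)) fun _ _ _ => sq_nonneg _
      _ ≤ _ := Finset.sum_le_sum hle
      _ = _ := by rw [← Finset.mul_sum, Finset.sum_add_distrib]
  -- The relative size of the drift. `q ≤ 1/256` absorbs `E` into itself, and `(G/λ) q ≤ 1/128`
  -- absorbs the drift into half of `S`.
  set q := (L * (η / lam)) ^ 2 / β ^ 2 with hq
  have h4 : DD ≤ 2 * q * (S + E) := by
    have : DD ≤ 2 * (L * (η / lam)) ^ 2 * (S + E) / β ^ 2 := by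
      rw [le_div_iff₀ (by positivity)]; linarith
    calc DD ≤ _ := this
      _ = _ := by rw [hq]; ring
  have hq1 : q ≤ 1 / 256 := by
    have : (L * η) ^ 2 ≤ (lam * β / 16) ^ 2 := by gcongr
    rw [hq, div_le_iff₀ (by positivity)]
    have e : (L * (η / lam)) ^ 2 = (L * η) ^ 2 / lam ^ 2 := by field_simp
    rw [e, div_le_iff₀ (by positivity)]
    nlinarith
  have hq2 : G / lam * q ≤ 1 / 128 := by
    have e : G / lam * q = (L * η) ^ 2 * G / (lam ^ 3 * β ^ 2) := by
      rw [hq]; field_simp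
    rw [e, div_le_iff₀ (by positivity)]
    linarith
  have hq0 : 0 ≤ q := by positivity
  have h5 : E ≤ 8 * (q * S) + 4 * NN := by nlinarith [mul_le_mul_of_nonneg_right hq1 hE0]
  have h6 : S ≤ 8 * G / η * (F 0 - F t) + 8 * (G / lam) * E := by
    have h7 := mul_le_mul_of_nonneg_left h1 (show 0 ≤ 8 * G / η by positivity)
    have e1 : 8 * G / η * (η / (8 * G) * S) = S := by field_simp
    have e2 : 8 * G / η * (F 0 - F t + η / lam * E) =
      8 * G / η * (F 0 - F t) + 8 * (G / lam) * E := by field_simp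
    rwa [e1, e2] at h7
  have h8 : G / lam * E ≤ 8 * (1 / 128 * S) + 4 * (G / lam * NN) := by
    have h9 := mul_le_mul_of_nonneg_left h5 (show 0 ≤ G / lam by positivity)
    have h10 := mul_le_mul_of_nonneg_right hq2 hS0
    linarith
  have e3 : 16 * G * (F 0 - F t) / η = 2 * (8 * G / η * (F 0 - F t)) := by ring
  have e4 : 64 * G / lam * NN = 64 * (G / lam * NN) := by ring
  rw [e3, e4]
  linarith

/-- If a sequence grows by at most `κ` per step while its square sum is small, it stays below
`G`. -/
theorem norm_le_of_sum_sq_le {E : Type*} [NormedAddCommGroup E] {A : ℕ → E} {G κ : ℝ} (hG : 0 < G)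
    (hκ0 : 0 ≤ κ) (hκ : κ ≤ G / 4) (hA0 : 2 * ‖A 0‖ ≤ G) {t : ℕ}
    (hstep : ∀ k < t, ‖A (k + 1) - A k‖ ≤ κ) :
    ‖A t‖ ≤ 3 / 4 * G + 4 * κ / G ^ 2 * ∑ k ∈ Finset.range t, ‖A k‖ ^ 2 := by
  induction t with
  | zero => simp; linarith
  | succ t ih =>
    have ih := ih fun k hk => hstep k (hk.trans t.lt_succ_self)
    have h1 := hstep t t.lt_succ_self
    have h2 : ‖A (t + 1)‖ ≤ ‖A t‖ + κ := by
      have := norm_sub_norm_le (A (t + 1)) (A t)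
      linarith
    have h3 : 0 ≤ ∑ k ∈ Finset.range t, ‖A k‖ ^ 2 := Finset.sum_nonneg fun _ _ => sq_nonneg _
    rw [Finset.sum_range_succ]
    -- From below `G/2` one step of at most `G/4` ends below `3G/4`; above `G/2` the increase `κ` is
    -- paid for by `‖A t‖² ≥ G²/4`.
    rcases le_total ‖A t‖ (G / 2) with h | h
    · have : 0 ≤ 4 * κ / G ^ 2 * (∑ k ∈ Finset.range t, ‖A k‖ ^ 2 + ‖A t‖ ^ 2) := by positivity
      linarith
    · have h4 : (G / 2) ^ 2 ≤ ‖A t‖ ^ 2 := by gcongr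
      have h5 : κ ≤ 4 * κ / G ^ 2 * ‖A t‖ ^ 2 := by
        rw [div_mul_eq_mul_div, le_div_iff₀ (by positivity)]
        nlinarith
      linarith

/-- Gradient bounds along a trajectory on which the averaged noise is small. -/
theorem IsAdamTrajectory.gradient_bounds {d : ℕ} {α : ℕ → ℝ} {η lam β G L σ Δ Q : ℝ}
    {A n y : ℕ → RVec d} {F : ℕ → ℝ} {T : ℕ}
    (h : IsAdamTrajectory α η lam (fun k => A k + n k) y)
    (hβ : 0 < β) (hαβ : ∀ k, β ≤ α k) (hα1 : ∀ k, α k ≤ 1) (hη : 0 < η) (hlam : 0 < lam)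
    (hG : 2 * lam ≤ G) (hσG : 2 * σ ≤ G) (hL : 0 ≤ L)
    (hLη : L * η ≤ lam * β / 16) (hLη2 : (L * η) ^ 2 * G ≤ lam ^ 3 * β ^ 2 / 128)
    (hκ : L * (η * Real.sqrt d) ≤ G / 4)
    (hn : ∀ k < T, ‖n k‖ ≤ σ) (hA0 : 2 * ‖A 0‖ ≤ G)
    (hlip : ∀ k < T, ‖A k‖ ≤ G → ‖A (k + 1) - A k‖ ≤ L * ‖y (k + 1) - y k‖ ∧
      F (k + 1) - F k ≤ inner ℝ (A k) (y (k + 1) - y k) + L * ‖y (k + 1) - y k‖ ^ 2)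
    (hF : ∀ k ≤ T, F 0 - F k ≤ Δ)
    (hQ : ∑ k ∈ Finset.range T, ‖expAverage α n k‖ ^ 2 ≤ Q)
    (hB : 16 * (L * (η * Real.sqrt d)) * (16 * G * Δ / η + 64 * G / lam * Q) ≤ G ^ 3) :
    (∀ k < T, ‖A k‖ ≤ G) ∧
      ∑ k ∈ Finset.range T, ‖A k‖ ^ 2 ≤ 16 * G * Δ / η + 64 * G / lam * Q := by
  have hα0 : ∀ k, 0 ≤ α k := fun k => hβ.le.trans (hαβ k)
  have hG0 : 0 < G := by linarith
  have hsum : ∀ t ≤ T, (∀ k < t, ‖A k‖ ≤ G) →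
      ∑ k ∈ Finset.range t, ‖A k‖ ^ 2 ≤ 16 * G * Δ / η + 64 * G / lam * Q := by
    intro t ht hA
    refine (h.sum_sq_gradient_le (F := F) hβ hαβ hα1 hη hlam hG hσG hL hLη hLη2
      (fun k hk => hn k (hk.trans_le ht)) hA
      (fun k hk => (hlip k (hk.trans_le ht) (hA k hk)).1)
      (fun k hk => (hlip k (hk.trans_le ht) (hA k hk)).2)).trans ?_
    have h1 := hF t ht
    have h2 : ∑ k ∈ Finset.range t, ‖expAverage α n k‖ ^ 2 ≤ Q :=
      (Finset.sum_le_sum_of_subset_of_nonneg (Finset.range_mono ht)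
        fun _ _ _ => sq_nonneg _).trans hQ
    gcongr
  have hA : ∀ t < T, ‖A t‖ ≤ G := by
    intro t
    induction t using Nat.strong_induction_on with
    | _ t ih =>
      intro ht
      have hb : ∀ k < t, ‖A k‖ ≤ G := fun k hk => ih k hk (hk.trans ht)
      have h1 := norm_le_of_sum_sq_le (A := A) (t := t) hG0 (by positivity) hκ hA0 fun k hk =>
        (hlip k (hk.trans ht) (hb k hk)).1.trans
          (mul_le_mul_of_nonneg_left (h.norm_step_le_sqrt hα0 hα1 hη.le hlam k) hL)
      have h2 := hsum t ht.le hb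
      -- The budget `hB` leaves at most `G/4`, which together with `3G/4` closes the induction.
      have h3 : 4 * (L * (η * Real.sqrt d)) / G ^ 2 * ∑ k ∈ Finset.range t, ‖A k‖ ^ 2 ≤ G / 4 := by
        rw [div_mul_eq_mul_div, div_le_iff₀ (by positivity)]
        have h4 := mul_le_mul_of_nonneg_left h2
          (show 0 ≤ 16 * (L * (η * Real.sqrt d)) by positivity)
        nlinarith
      linarith
  exact ⟨hA, hsum T le_rfl hA⟩

end TrajectoryBounds

/-! ### Bias correction as a choice of averaging weights. -/

section BiasCorrection

/-- The weight `β / (1 - (1 - β) ^ (k + 1))` of the newest gradient in the bias-corrected average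
of iteration `k + 1`. -/
noncomputable def biasWeight (β : ℝ) (k : ℕ) : ℝ := β / (1 - (1 - β) ^ (k + 1))

theorem one_sub_pow_pos {β : ℝ} (hβ : 0 < β) (hβ1 : β ≤ 1) (k : ℕ) :
    0 < 1 - (1 - β) ^ (k + 1) :=
  sub_pos.2 (pow_lt_one₀ (by linarith) (by linarith) k.succ_ne_zero)

theorem le_biasWeight {β : ℝ} (hβ : 0 < β) (hβ1 : β ≤ 1) (k : ℕ) : β ≤ biasWeight β k := by
  rw [biasWeight, le_div_iff₀ (one_sub_pow_pos hβ hβ1 k)]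
  have : 0 ≤ (1 - β) ^ (k + 1) := pow_nonneg (by linarith) _
  nlinarith

theorem biasWeight_le_one {β : ℝ} (hβ : 0 < β) (hβ1 : β ≤ 1) (k : ℕ) : biasWeight β k ≤ 1 := by
  rw [biasWeight, div_le_one (one_sub_pow_pos hβ hβ1 k)]
  have : (1 - β) ^ (k + 1) ≤ 1 - β := pow_le_of_le_one (by linarith) (by linarith) k.succ_ne_zero
  linarith

/-- By Bernoulli, `(1 - β)ⁿ (1 + nβ) ≤ (1 - β²)ⁿ ≤ 1`. The early weights are large, but their excess
over `β` is square summable. -/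
theorem biasWeight_le {β : ℝ} (hβ : 0 < β) (hβ1 : β ≤ 1) (k : ℕ) :
    biasWeight β k ≤ β + 1 / (k + 1) := by
  have hk : (0 : ℝ) < k + 1 := by positivity
  have h1 : (1 - β) ^ (k + 1) * (1 + (k + 1) * β) ≤ 1 := by
    have h2 : 1 + ((k + 1 : ℕ) : ℝ) * β ≤ (1 + β) ^ (k + 1) :=
      one_add_mul_le_pow (by linarith) _
    push_cast at h2
    calc (1 - β) ^ (k + 1) * (1 + (k + 1) * β) ≤ (1 - β) ^ (k + 1) * (1 + β) ^ (k + 1) := by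
          gcongr
      _ = (1 - β ^ 2) ^ (k + 1) := by rw [← mul_pow]; ring
      _ ≤ 1 := pow_le_one₀ (by nlinarith) (by nlinarith)
  rw [biasWeight, div_le_iff₀ (one_sub_pow_pos hβ hβ1 k)]
  have e : (β + 1 / ((k : ℝ) + 1)) = (1 + (k + 1) * β) / (k + 1) := by field_simp; ring
  rw [e, div_mul_eq_mul_div, le_div_iff₀ hk]
  nlinarith

theorem sum_one_div_sq_le (T : ℕ) : ∑ k ∈ Finset.range T, (1 / ((k : ℝ) + 1)) ^ 2 ≤ 2 := by
  have h : ∀ T : ℕ, ∑ k ∈ Finset.range T, (1 / ((k : ℝ) + 1)) ^ 2 ≤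
      2 - if T = 0 then 1 else 1 / (T : ℝ) := by
    intro T
    induction T with
    | zero => norm_num
    | succ T ih =>
      rw [Finset.sum_range_succ]
      rcases T.eq_zero_or_pos with rfl | hT
      · norm_num
      · have hT' : (0 : ℝ) < T := by exact_mod_cast hT
        simp only [hT.ne', if_false, Nat.succ_ne_zero] at ih ⊢
        have : (1 / ((T : ℝ) + 1)) ^ 2 ≤ 1 / (T : ℝ) - 1 / ((T : ℝ) + 1) := by
          rw [div_sub_div _ _ hT'.ne' (by positivity), div_pow, one_pow,
            div_le_div_iff₀ (by positivity) (by positivity)]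
          nlinarith
        push_cast
        linarith
  have h1 := h T
  have h2 : (0 : ℝ) ≤ if T = 0 then (1 : ℝ) else 1 / (T : ℝ) := by split_ifs <;> positivity
  linarith

/-- The sum is at most `2β²T + 4`; the requirement `T ≥ 1/β²` serves to absorb the constant. -/
theorem sum_sq_biasWeight_le {β : ℝ} (hβ : 0 < β) (hβ1 : β ≤ 1) {T : ℕ} (hT : 1 ≤ β ^ 2 * T) :
    ∑ k ∈ Finset.range T, biasWeight β k ^ 2 ≤ 6 * (β ^ 2 * T) := by
  have h1 : ∀ k ∈ Finset.range T, biasWeight β k ^ 2 ≤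
      2 * β ^ 2 + 2 * (1 / ((k : ℝ) + 1)) ^ 2 := by
    intro k _
    have h0 : 0 ≤ biasWeight β k := hβ.le.trans (le_biasWeight hβ hβ1 k)
    have h2 : biasWeight β k ^ 2 ≤ (β + 1 / ((k : ℝ) + 1)) ^ 2 := by
      gcongr; exact biasWeight_le hβ hβ1 k
    nlinarith [sq_nonneg (β - 1 / ((k : ℝ) + 1))]
  have h3 := Finset.sum_le_sum h1
  rw [Finset.sum_add_distrib, Finset.sum_const, Finset.card_range,
    nsmul_eq_mul] at h3
  rw [← Finset.mul_sum] at h3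
  nlinarith [sum_one_div_sq_le T]

/-- Bias-corrected exponential moving averages are the averages with weights `biasWeight β`. -/
theorem div_one_sub_pow_eq_expAverage {β : ℝ} (hβ : 0 < β) (hβ1 : β ≤ 1) {s u : ℕ → ℝ}
    (hs0 : s 0 = 0) (hs : ∀ k, s (k + 1) = (1 - β) * s k + β * u k) (k : ℕ) :
    s (k + 1) / (1 - (1 - β) ^ (k + 1)) = expAverage (biasWeight β) u k := by
  induction k with
  | zero =>
    rw [hs, hs0]
    simp only [expAverage]
    simp [mul_div_cancel_left₀ _ hβ.ne']
  | succ k ih =>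
    have h1 := (one_sub_pow_pos hβ hβ1 k).ne'
    have h2 := (one_sub_pow_pos hβ hβ1 (k + 1)).ne'
    rw [hs, expAverage, ← ih, biasWeight, smul_eq_mul, smul_eq_mul]
    rw [pow_succ _ (k + 1)] at h2 ⊢
    generalize (1 - β) ^ (k + 1) = p at h1 h2 ⊢
    have e : 1 - β / (1 - p * (1 - β)) = (1 - β) * (1 - p) / (1 - p * (1 - β)) := by
      rw [eq_div_iff h2, sub_mul, div_mul_cancel₀ _ h2]; ring
    rw [e, div_mul_div_comm, mul_right_comm, mul_div_mul_right _ _ h1, div_mul_eq_mul_div, add_div]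

variable {d : ℕ} {Ξ : Type v} {g : RVec d → Ξ → RVec d} {β η lam : ℝ} {xinit : RVec d}
  {z : ℕ → Ξ}

/-- Index `k` stands for iteration `t = k + 1`, so the trajectory starts at `x_1`. -/
theorem isAdamTrajectory_adamIter (hβ : 0 < β) (hβ1 : β ≤ 1) :
    IsAdamTrajectory (biasWeight β) η lam
      (fun k => g (adamIter g β β η lam xinit z (k + 1)) (z (k + 1)))
      (fun k => adamIter g β β η lam xinit z (k + 1)) := by
  refine ⟨fun k i => ?_⟩
  have hm := div_one_sub_pow_eq_expAverage hβ hβ1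
    (s := fun k => (adamState g β β η lam xinit z k).m i)
    (u := fun k => g (adamIter g β β η lam xinit z (k + 1)) (z (k + 1)) i) rfl
    (fun k => rfl) k
  have hv := div_one_sub_pow_eq_expAverage hβ hβ1
    (s := fun k => (adamState g β β η lam xinit z k).v i)
    (u := fun k => g (adamIter g β β η lam xinit z (k + 1)) (z (k + 1)) i ^ 2) rfl
    (fun k => rfl) k
  rw [expAverage_apply, ← hm, ← hv]
  have h3 : adamIter g β β η lam xinit z (k + 1 + 1) i =
      adamIter g β β η lam xinit z (k + 1) i -
        η / (Real.sqrt ((adamState g β β η lam xinit z (k + 1)).v i / (1 - (1 - β) ^ (k + 1))) +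
          lam) * ((adamState g β β η lam xinit z (k + 1)).m i / (1 - (1 - β) ^ (k + 1))) := rfl
  rw [h3]
  ring

end BiasCorrection

/-! ### Azuma-Hoeffding for inner products with predictable vectors. -/

section Concentration

/-- On `[-c, c]` the convex exponential lies below its chord, and `cosh y ≤ exp (y²/2)`. The term
linear in `x` is the one that will vanish in expectation. -/
theorem Real.exp_mul_le_of_abs_le {x c : ℝ} (hx : |x| ≤ c) (θ : ℝ) :
    Real.exp (θ * x) ≤ Real.exp ((θ * c) ^ 2 / 2) + Real.sinh (θ * c) / c * x := by
  rcases ((abs_nonneg x).trans hx).eq_or_lt with rfl | hc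
  · simp [abs_nonpos_iff.1 hx]
  · have h1 : |x / c| ≤ 1 := by rwa [abs_div, abs_of_pos hc, div_le_one hc]
    have h2 := Real.exp_mul_le_cosh_add_mul_sinh h1 (θ * c)
    have e : x / c * (θ * c) = θ * x := by field_simp
    rw [e] at h2
    have h3 := Real.cosh_le_exp_half_sq (θ * c)
    have e2 : Real.sinh (θ * c) / c * x = x / c * Real.sinh (θ * c) := by ring
    linarith

variable {Ω E : Type*} {m₀ : MeasurableSpace Ω} {μ : Measure Ω} [IsProbabilityMeasure μ]
  [NormedAddCommGroup E] [InnerProductSpace ℝ E] [CompleteSpace E]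

theorem integral_inner_eq_zero_of_condExp_eq_zero {m : MeasurableSpace Ω} (hm : m ≤ m₀)
    {V u : Ω → E} {c : ℝ} (hV : StronglyMeasurable[m] V) (hVc : ∀ ω, ‖V ω‖ ≤ c)
    (hu : Integrable u μ) (hu0 : μ[u | m] =ᵐ[μ] 0) :
    ∫ ω, inner ℝ (V ω) (u ω) ∂μ = 0 := by
  have h1 := condExp_stronglyMeasurable_bilin_of_bound (innerSL ℝ) hm hV hu c (ae_of_all _ hVc)
  have h2 : μ[fun ω => inner ℝ (V ω) (u ω) | m] =ᵐ[μ] 0 := by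
    refine h1.trans ?_
    filter_upwards [hu0] with ω hω
    simp [hω]
  rw [← integral_condExp hm, integral_congr_ae h2]
  simp

/-- The moment generating function bound behind the Azuma–Hoeffding inequality, for increments
which are inner products of a predictable vector with a centered bounded one. -/
theorem integral_exp_sum_inner_le (𝓕 : Filtration ℕ m₀) {W u : ℕ → Ω → E} {w : ℕ → ℝ} {σ : ℝ}
    {T : ℕ} (hW : ∀ k, StronglyMeasurable[𝓕 k] (W k)) (hWw : ∀ k ω, ‖W k ω‖ ≤ w k)
    (hu : ∀ k, StronglyMeasurable[𝓕 (k + 1)] (u k)) (huσ : ∀ k ω, ‖u k ω‖ ≤ σ)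
    (hu0 : ∀ k < T, μ[u k | 𝓕 k] =ᵐ[μ] 0) (θ : ℝ) {t : ℕ} (ht : t ≤ T) :
    Integrable (fun ω => Real.exp (θ * ∑ k ∈ Finset.range t, inner ℝ (W k ω) (u k ω))) μ ∧
    ∫ ω, Real.exp (θ * ∑ k ∈ Finset.range t, inner ℝ (W k ω) (u k ω)) ∂μ ≤
      Real.exp (θ ^ 2 / 2 * ∑ k ∈ Finset.range t, (w k * σ) ^ 2) := by
  have hX : ∀ k ω, |(inner ℝ (W k ω) (u k ω) : ℝ)| ≤ w k * σ := fun k ω =>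
    (abs_real_inner_le_norm _ _).trans (mul_le_mul (hWw k ω) (huσ k ω) (norm_nonneg _)
      ((norm_nonneg _).trans (hWw k ω)))
  set S : ℕ → Ω → ℝ := fun t ω => ∑ k ∈ Finset.range t, inner ℝ (W k ω) (u k ω) with hS
  have hSm : ∀ t, StronglyMeasurable[𝓕 t] (S t) := by
    intro t
    refine Finset.stronglyMeasurable_fun_sum _ fun k hk => ?_
    have hk' : k + 1 ≤ t := Finset.mem_range.1 hk
    exact ((hW k).mono (𝓕.mono (by omega))).inner ((hu k).mono (𝓕.mono hk'))
  have hSb : ∀ t ω, |S t ω| ≤ ∑ k ∈ Finset.range t, w k * σ := fun t ω =>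
    (Finset.abs_sum_le_sum_abs _ _).trans (Finset.sum_le_sum fun k _ => hX k ω)
  have hYm : ∀ t, StronglyMeasurable[𝓕 t] (fun ω => Real.exp (θ * S t ω)) := fun t =>
    Real.continuous_exp.comp_stronglyMeasurable ((hSm t).const_mul θ)
  have hYb : ∀ t ω, ‖Real.exp (θ * S t ω)‖ ≤
      Real.exp (|θ| * ∑ k ∈ Finset.range t, w k * σ) := fun t ω => by
    rw [Real.norm_of_nonneg (Real.exp_nonneg _)]
    refine Real.exp_le_exp.2 ((le_abs_self _).trans ?_)
    rw [abs_mul]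
    gcongr
    exact hSb t ω
  have hYi : ∀ t, Integrable (fun ω => Real.exp (θ * S t ω)) μ := fun t =>
    Integrable.of_bound ((hYm t).mono (𝓕.le t)).aestronglyMeasurable _ (ae_of_all _ (hYb t))
  have hui : ∀ k, Integrable (u k) μ := fun k =>
    Integrable.of_bound ((hu k).mono (𝓕.le _)).aestronglyMeasurable _ (ae_of_all _ (huσ k))
  refine ⟨hYi t, ?_⟩
  change ∫ ω, Real.exp (θ * S t ω) ∂μ ≤ _
  induction t with
  | zero => simp [hS]
  | succ t ih =>
    have ih := ih (by omega)
    set b := Real.sinh (θ * (w t * σ)) / (w t * σ)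
    set C := Real.exp ((θ * (w t * σ)) ^ 2 / 2)
    -- The factor `exp (θ S t) • W t` is predictable and bounded, so the last term integrates to
    -- zero.
    have hle : ∀ ω, Real.exp (θ * S (t + 1) ω) ≤ C * Real.exp (θ * S t ω) +
        b * inner ℝ (Real.exp (θ * S t ω) • W t ω) (u t ω) := by
      intro ω
      have h1 := Real.exp_mul_le_of_abs_le (hX t ω) θ
      have e : θ * S (t + 1) ω = θ * S t ω + θ * inner ℝ (W t ω) (u t ω) := by
        simp only [hS, Finset.sum_range_succ, mul_add]
      rw [e, Real.exp_add, real_inner_smul_left]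
      have h2 := mul_le_mul_of_nonneg_left h1 (Real.exp_nonneg (θ * S t ω))
      linarith
    have hVm : StronglyMeasurable[𝓕 t] fun ω => Real.exp (θ * S t ω) • W t ω :=
      (hYm t).smul (hW t)
    have hVb : ∀ ω, ‖Real.exp (θ * S t ω) • W t ω‖ ≤
        Real.exp (|θ| * ∑ k ∈ Finset.range t, w k * σ) * w t := fun ω => by
      rw [norm_smul]
      exact mul_le_mul (hYb t ω) (hWw t ω) (norm_nonneg _) (Real.exp_nonneg _)
    have hzero := integral_inner_eq_zero_of_condExp_eq_zero (μ := μ) (𝓕.le t) hVm hVb (hui t)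
      (hu0 t (by omega))
    have hVi : Integrable (fun ω => inner ℝ (Real.exp (θ * S t ω) • W t ω) (u t ω)) μ := by
      refine Integrable.of_bound (((hVm.mono (𝓕.le t)).inner
        ((hu t).mono (𝓕.le _))).aestronglyMeasurable)
        (Real.exp (|θ| * ∑ k ∈ Finset.range t, w k * σ) * w t * σ) (ae_of_all _ fun ω => ?_)
      exact (norm_inner_le_norm _ _).trans (mul_le_mul (hVb ω) (huσ t ω) (norm_nonneg _)
        ((norm_nonneg _).trans (hVb ω)))
    calc ∫ ω, Real.exp (θ * S (t + 1) ω) ∂μ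
        ≤ ∫ ω, (C * Real.exp (θ * S t ω) +
            b * inner ℝ (Real.exp (θ * S t ω) • W t ω) (u t ω)) ∂μ :=
          integral_mono (hYi _) (((hYi t).const_mul _).add (hVi.const_mul _)) hle
      _ = C * ∫ ω, Real.exp (θ * S t ω) ∂μ := by
          rw [integral_add ((hYi t).const_mul _) (hVi.const_mul _), integral_const_mul,
            integral_const_mul, hzero, mul_zero, add_zero]
      _ ≤ C * Real.exp (θ ^ 2 / 2 * ∑ k ∈ Finset.range t, (w k * σ) ^ 2) := by
          gcongr
      _ = _ := by
          rw [← Real.exp_add, Finset.sum_range_succ]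
          congr 1
          ring

/-- Chernoff's bound with the optimal parameter `θ = a / V`. -/
theorem measureReal_sum_inner_ge_le (𝓕 : Filtration ℕ m₀) {W u : ℕ → Ω → E} {w : ℕ → ℝ} {σ : ℝ}
    {T : ℕ} (hW : ∀ k, StronglyMeasurable[𝓕 k] (W k)) (hWw : ∀ k ω, ‖W k ω‖ ≤ w k)
    (hu : ∀ k, StronglyMeasurable[𝓕 (k + 1)] (u k)) (huσ : ∀ k ω, ‖u k ω‖ ≤ σ)
    (hu0 : ∀ k < T, μ[u k | 𝓕 k] =ᵐ[μ] 0) {V a : ℝ} (hV : 0 < V) (ha : 0 ≤ a)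
    (hwV : ∑ k ∈ Finset.range T, (w k * σ) ^ 2 ≤ V) :
    μ.real {ω | a ≤ ∑ k ∈ Finset.range T, inner ℝ (W k ω) (u k ω)} ≤
      Real.exp (-(a ^ 2 / (2 * V))) := by
  obtain ⟨hi, hle⟩ := integral_exp_sum_inner_le (μ := μ) 𝓕 hW hWw hu huσ hu0 (a / V) le_rfl
  refine (ProbabilityTheory.measure_ge_le_exp_mul_mgf a (by positivity) hi).trans ?_
  have h1 : Real.exp ((a / V) ^ 2 / 2 * ∑ k ∈ Finset.range T, (w k * σ) ^ 2) ≤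
      Real.exp ((a / V) ^ 2 / 2 * V) := by gcongr
  calc Real.exp (-(a / V) * a) * ProbabilityTheory.mgf _ μ (a / V)
      ≤ Real.exp (-(a / V) * a) * Real.exp ((a / V) ^ 2 / 2 * V) := by
        gcongr
        exact hle.trans h1
    _ = _ := by
        rw [← Real.exp_add]
        congr 1
        field_simp
        ring

end Concentration

/-! ### High-probability bound for the averaged noise. -/

section AveragedNoise

theorem stronglyMeasurable_expAverage {Ω E : Type*} {m : MeasurableSpace Ω}
    [NormedAddCommGroup E] [NormedSpace ℝ E] {α : ℕ → ℝ} {u : ℕ → Ω → E} {k : ℕ}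
    (hu : ∀ j ≤ k, StronglyMeasurable (u j)) :
    StronglyMeasurable fun ω => expAverage α (fun j => u j ω) k := by
  induction k with
  | zero => exact hu 0 le_rfl
  | succ k ih =>
    exact ((ih fun j hj => hu j (hj.trans k.le_succ)).const_smul _).add
      ((hu (k + 1) le_rfl).const_smul _)

/-- The predictable factors of the martingale part of the squared averages. -/
noncomputable def averageWeight {E : Type*} [AddCommGroup E] [Module ℝ E] (α : ℕ → ℝ)
    (u : ℕ → E) : ℕ → E
  | 0 => 0
  | k + 1 => (2 * α (k + 1) * (1 - α (k + 1))) • expAverage α u k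

/-- In `‖(1 - α)N + αu‖²` the cross term is a martingale increment once `u` is centered noise, and
`(1 - α)² ≤ 1 - β` yields the gain `β‖N‖²` at each step. -/
theorem mul_sum_sq_expAverage_le {E : Type*} [NormedAddCommGroup E] [InnerProductSpace ℝ E]
    {α : ℕ → ℝ} {u : ℕ → E} {β σ : ℝ} (hβ : 0 < β) (hαβ : ∀ k, β ≤ α k) (hα1 : ∀ k, α k ≤ 1)
    (hu : ∀ k, ‖u k‖ ≤ σ) (T : ℕ) :
    β * ∑ k ∈ Finset.range T, ‖expAverage α u k‖ ^ 2 ≤ σ ^ 2 +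
      σ ^ 2 * ∑ k ∈ Finset.range T, α k ^ 2 +
      ∑ k ∈ Finset.range T, inner ℝ (averageWeight α u k) (u k) := by
  have hβ1 : β ≤ 1 := (hαβ 0).trans (hα1 0)
  have hu2 : ∀ k, ‖u k‖ ^ 2 ≤ σ ^ 2 := fun k => by
    have := hu k
    gcongr
  have key : ∀ t, β * ∑ k ∈ Finset.range (t + 1), ‖expAverage α u k‖ ^ 2 +
      (1 - β) * ‖expAverage α u t‖ ^ 2 ≤ σ ^ 2 +
      σ ^ 2 * ∑ k ∈ Finset.range (t + 1), α k ^ 2 +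
      ∑ k ∈ Finset.range (t + 1), inner ℝ (averageWeight α u k) (u k) := by
    intro t
    induction t with
    | zero =>
      simp only [zero_add, Finset.sum_range_one, expAverage, averageWeight, inner_zero_left]
      nlinarith [hu2 0, mul_nonneg (sq_nonneg σ) (sq_nonneg (α 0))]
    | succ t ih =>
      rw [Finset.sum_range_succ (fun k => ‖expAverage α u k‖ ^ 2) (t + 1),
        Finset.sum_range_succ (fun k => α k ^ 2) (t + 1),
        Finset.sum_range_succ (fun k => inner ℝ (averageWeight α u k) (u k)) (t + 1)]
      have e : ‖expAverage α u (t + 1)‖ ^ 2 = (1 - α (t + 1)) ^ 2 * ‖expAverage α u t‖ ^ 2 +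
          inner ℝ (averageWeight α u (t + 1)) (u (t + 1)) +
          α (t + 1) ^ 2 * ‖u (t + 1)‖ ^ 2 := by
        rw [expAverage, averageWeight, norm_add_sq_real, norm_smul, norm_smul, mul_pow, mul_pow,
          Real.norm_eq_abs, Real.norm_eq_abs, sq_abs, sq_abs, real_inner_smul_left,
          real_inner_smul_left, real_inner_smul_right]
        ring
      have h1 : (1 - α (t + 1)) ^ 2 * ‖expAverage α u t‖ ^ 2 ≤
          (1 - β) * ‖expAverage α u t‖ ^ 2 := by
        gcongr
        nlinarith [hαβ (t + 1), hα1 (t + 1)]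
      have h2 : α (t + 1) ^ 2 * ‖u (t + 1)‖ ^ 2 ≤ α (t + 1) ^ 2 * σ ^ 2 := by
        gcongr
        exact hu _
      nlinarith
  cases T with
  | zero => simp; positivity
  | succ t =>
    have h1 := key t
    have : 0 ≤ (1 - β) * ‖expAverage α u t‖ ^ 2 := mul_nonneg (by linarith) (sq_nonneg _)
    linarith

/-- With probability at least `1 - δ` the averaged noise is small in square mean. -/
theorem measure_sum_sq_expAverage_gt_le {Ω E : Type*} {m₀ : MeasurableSpace Ω} {μ : Measure Ω}
    [IsProbabilityMeasure μ] [NormedAddCommGroup E] [InnerProductSpace ℝ E] [CompleteSpace E]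
    (𝓕 : Filtration ℕ m₀) {u : ℕ → Ω → E} {β σ δ : ℝ} {T : ℕ}
    (hu : ∀ k, StronglyMeasurable[𝓕 (k + 1)] (u k)) (huσ : ∀ k ω, ‖u k ω‖ ≤ σ)
    (hu0 : ∀ k < T, μ[u k | 𝓕 k] =ᵐ[μ] 0) (hβ : 0 < β) (hβ1 : β ≤ 1) (hT : 1 ≤ β ^ 2 * T)
    (hσ : 0 ≤ σ) (hδ : 0 < δ) :
    μ {ω | 14 * (σ ^ 2 * β * T * Real.sqrt (logFactor δ)) <
      ∑ k ∈ Finset.range T, ‖expAverage (biasWeight β) (fun j => u j ω) k‖ ^ 2} ≤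
      ENNReal.ofReal δ := by
  set α := biasWeight β
  set ι := logFactor δ with hι
  have hι1 : 1 ≤ ι := le_max_left _ _
  have hαβ : ∀ k, β ≤ α k := le_biasWeight hβ hβ1
  have hα1 : ∀ k, α k ≤ 1 := biasWeight_le_one hβ hβ1
  have hα0 : ∀ k, 0 ≤ α k := fun k => hβ.le.trans (hαβ k)
  have hα2 : ∑ k ∈ Finset.range T, α k ^ 2 ≤ 6 * (β ^ 2 * T) := sum_sq_biasWeight_le hβ hβ1 hT
  rcases hσ.eq_or_lt with rfl | hσ0
  · have h0 : ∀ ω k, expAverage α (fun j => u j ω) k = 0 := fun ω k =>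
      norm_le_zero_iff.1 (norm_expAverage_le hα0 hα1 fun j _ => huσ j ω)
    simp [h0]
  have hs1 : 1 ≤ Real.sqrt ι := Real.one_le_sqrt.2 hι1
  set P := β ^ 2 * T with hP
  have hPs : Real.sqrt P ≤ P := Real.sqrt_le_left (by linarith) |>.2 (by nlinarith)
  -- The variance proxy is `4σ⁴ ∑ α² ≤ 24σ⁴P`, and `49/48 ≥ 1` makes the tail at most `exp (-ι) ≤
  -- δ`.
  set a := 7 * σ ^ 2 * (Real.sqrt P * Real.sqrt ι) with ha
  set V := 24 * σ ^ 4 * P with hV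
  have hVpos : 0 < V := by positivity
  set w : ℕ → ℝ := fun k => 2 * α k * σ with hw
  have hN : ∀ k ω, ‖expAverage α (fun j => u j ω) k‖ ≤ σ := fun k ω =>
    norm_expAverage_le hα0 hα1 fun j _ => huσ j ω
  have htail := measureReal_sum_inner_ge_le (μ := μ) 𝓕
    (W := fun k ω => averageWeight α (fun j => u j ω) k) (u := u) (w := w) (σ := σ) (T := T)
    (fun k => by
      cases k with
      | zero => exact stronglyMeasurable_zero
      | succ k => exact (stronglyMeasurable_expAverage fun j hj =>
          (hu j).mono (𝓕.mono (by omega))).const_smul _)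
    (fun k ω => by
      cases k with
      | zero =>
        simp only [averageWeight, norm_zero, hw]
        have := hα0 0
        positivity
      | succ k =>
        have h1 := hα0 (k + 1)
        have h2 := sub_nonneg.2 (hα1 (k + 1))
        simp only [averageWeight, hw, norm_smul]
        rw [Real.norm_of_nonneg (by positivity)]
        refine mul_le_mul ?_ (hN k ω) (norm_nonneg _) (by positivity)
        nlinarith)
    hu huσ hu0 (V := V) (a := a) hVpos (by positivity) (by
      have e : ∀ k, (w k * σ) ^ 2 = 4 * σ ^ 4 * α k ^ 2 := fun k => by rw [hw]; ring
      simp only [e, ← Finset.mul_sum]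
      rw [hV]
      nlinarith [pow_pos hσ0 4])
  have hexp : Real.exp (-(a ^ 2 / (2 * V))) ≤ δ := by
    have e : a ^ 2 = 49 * σ ^ 4 * (P * ι) := by
      rw [ha, mul_pow, mul_pow, mul_pow, Real.sq_sqrt (by linarith), Real.sq_sqrt (by linarith)]
      ring
    have h1 : ι ≤ a ^ 2 / (2 * V) := by
      rw [le_div_iff₀ (by positivity), e, hV]
      have : 0 ≤ σ ^ 4 * (P * ι) := by positivity
      nlinarith
    have h2 : Real.log (1 / δ) ≤ ι := le_max_right _ _
    rw [one_div, Real.log_inv] at h2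
    calc Real.exp (-(a ^ 2 / (2 * V))) ≤ Real.exp (Real.log δ) := Real.exp_le_exp.2 (by linarith)
      _ = δ := Real.exp_log hδ
  -- If the martingale is below `a`, then `β` times the sum is below `σ²(1 + 6P + 7√P√ι) ≤ 14σ²P√ι`,
  -- because `P, ι ≥ 1`.
  have hsub : {ω | 14 * (σ ^ 2 * β * T * Real.sqrt ι) <
      ∑ k ∈ Finset.range T, ‖expAverage α (fun j => u j ω) k‖ ^ 2} ⊆
      {ω | a ≤ ∑ k ∈ Finset.range T, inner ℝ (averageWeight α (fun j => u j ω) k) (u k ω)} := by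
    intro ω hω
    simp only [Set.mem_ofPred_eq] at hω ⊢
    by_contra! hlt
    have h1 := mul_sum_sq_expAverage_le hβ hαβ hα1 (fun k => huσ k ω) T
    have h2 := mul_lt_mul_of_pos_left hω hβ
    have h3 : a ≤ 7 * σ ^ 2 * (P * Real.sqrt ι) := by rw [ha]; gcongr
    have h4 : σ ^ 2 * ∑ k ∈ Finset.range T, α k ^ 2 ≤ σ ^ 2 * (6 * P) := by gcongr
    have h5 : β * (14 * (σ ^ 2 * β * T * Real.sqrt ι)) = 14 * (σ ^ 2 * (P * Real.sqrt ι)) := by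
      rw [hP]; ring
    have h6 : P ≤ P * Real.sqrt ι := le_mul_of_one_le_right (by linarith) hs1
    have h7 : σ ^ 2 * P ≤ σ ^ 2 * (P * Real.sqrt ι) := by gcongr
    have h8 : σ ^ 2 * 1 ≤ σ ^ 2 * P := by gcongr
    linarith
  refine (measure_mono hsub).trans ?_
  rw [ENNReal.le_ofReal_iff_toReal_le (measure_ne_top _ _) hδ.le]
  exact htail.trans hexp

end AveragedNoise

/-! ### Parameter conditions as real inequalities. -/

section Parameters

/-- Clearing denominators stays correct at `b = 0`: the quotient is `⊤` and the real inequality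
becomes `0 ≤ c * a`. -/
theorem ofReal_le_ofReal_mul_extDiv_iff {w c a b : ℝ} (hc : 0 < c) (ha : 0 < a) (hb : 0 ≤ b) :
    ENNReal.ofReal w ≤ ENNReal.ofReal c * extDiv a b ↔ w * b ≤ c * a := by
  unfold extDiv
  rcases hb.eq_or_lt with rfl | hb
  · have h1 : ENNReal.ofReal a ≠ 0 := by simpa using ha
    have h2 : ENNReal.ofReal c ≠ 0 := by simpa using hc
    simp only [ENNReal.ofReal_zero, ENNReal.div_zero h1, ENNReal.mul_top h2, le_top, mul_zero,
      true_iff]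
    positivity
  · rw [← ENNReal.ofReal_div_of_pos hb, ← ENNReal.ofReal_mul hc.le,
      ENNReal.ofReal_le_ofReal_iff (by positivity), ← mul_div_assoc, le_div_iff₀ hb]

theorem extDiv_div_ofReal {a b s : ℝ} (hb : 0 ≤ b) :
    extDiv a b / ENNReal.ofReal s = extDiv a (b * s) := by
  unfold extDiv
  rw [ENNReal.ofReal_mul hb, div_eq_mul_inv, div_eq_mul_inv, div_eq_mul_inv,
    ENNReal.mul_inv (Or.inr ENNReal.ofReal_ne_top) (Or.inl ENNReal.ofReal_ne_top), mul_assoc]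

theorem ofReal_le_mul_localRadius_div_iff {ρ L₀ Lρ G w c s : ℝ} (hL₀ : 0 ≤ L₀) (hLρ : 0 ≤ Lρ)
    (hG : 0 < G) (hc : 0 < c) (hs : 0 ≤ s) :
    ENNReal.ofReal w ≤ ENNReal.ofReal c * (localRadius ρ L₀ Lρ G / ENNReal.ofReal s) ↔
      w * (5 * Lρ * G ^ (ρ - 1) * s) ≤ c ∧
      (ρ ≠ 0 → L₀ ≠ 0 → w * (5 * (L₀ ^ (ρ - 1) * Lρ) ^ (1 / ρ) * s) ≤ c) := by
  unfold localRadius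
  rw [div_eq_mul_inv, min_mul, mul_min, ← div_eq_mul_inv, ← div_eq_mul_inv, le_min_iff,
    extDiv_div_ofReal (by positivity),
    ofReal_le_ofReal_mul_extDiv_iff hc one_pos (by positivity), mul_one]
  refine and_congr_right fun _ => ?_
  split_ifs with h
  · have hc' : ENNReal.ofReal c ≠ 0 := by simpa using hc
    simp only [ENNReal.top_div_of_ne_top ENNReal.ofReal_ne_top, ENNReal.mul_top hc', le_top,
      true_iff]
    intro h1 h2
    exact absurd h (by tauto)
  · rw [extDiv_div_ofReal (by positivity),
      ofReal_le_ofReal_mul_extDiv_iff hc one_pos (by positivity), mul_one]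
    push Not at h
    tauto

theorem effSmooth_nonneg {ρ L₀ Lρ G : ℝ} (hL₀ : 0 ≤ L₀) (hLρ : 0 ≤ Lρ) (hG : 0 < G) :
    0 ≤ effSmooth ρ L₀ Lρ G := by
  unfold effSmooth; positivity

/-- The step size condition of `AdamChoice` as inequalities between real numbers. -/
theorem eta_le_iff {d : ℕ} {ρ L₀ Lρ lam ι c₂ G β η : ℝ} (hL₀ : 0 ≤ L₀) (hLρ : 0 ≤ Lρ)
    (hlam : 0 < lam) (hG : 0 < G) (hβ : 0 < β) (hc₂ : 0 < c₂) :
    ENNReal.ofReal η ≤ ENNReal.ofReal c₂ *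
      min (localRadius ρ L₀ Lρ G / ENNReal.ofReal (Real.sqrt d))
        (min (extDiv (lam * β) (Real.sqrt (d * ι) * effSmooth ρ L₀ Lρ G))
          (extDiv (lam ^ (3 / 2 : ℝ) * β) (effSmooth ρ L₀ Lρ G * Real.sqrt G))) ↔
    (η * (5 * Lρ * G ^ (ρ - 1) * Real.sqrt d) ≤ c₂ ∧
      (ρ ≠ 0 → L₀ ≠ 0 → η * (5 * (L₀ ^ (ρ - 1) * Lρ) ^ (1 / ρ) * Real.sqrt d) ≤ c₂)) ∧
    η * (Real.sqrt (d * ι) * effSmooth ρ L₀ Lρ G) ≤ c₂ * (lam * β) ∧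
    η * (effSmooth ρ L₀ Lρ G * Real.sqrt G) ≤ c₂ * (lam ^ (3 / 2 : ℝ) * β) := by
  have hL := effSmooth_nonneg (ρ := ρ) hL₀ hLρ hG
  rw [mul_min, mul_min, le_min_iff, le_min_iff,
    ofReal_le_mul_localRadius_div_iff hL₀ hLρ hG hc₂ (Real.sqrt_nonneg _),
    ofReal_le_ofReal_mul_extDiv_iff hc₂ (by positivity) (by positivity),
    ofReal_le_ofReal_mul_extDiv_iff hc₂ (by positivity) (by positivity)]

/-- The condition on `β` of `AdamChoice` as inequalities between real numbers. -/
theorem beta_le_iff {lam σ ι ε c₁ G β : ℝ} (hlam : 0 < lam) (hG : 0 < G) (hε : 0 < ε)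
    (hc₁ : 0 < c₁) :
    ENNReal.ofReal β ≤ min 1 (extDiv (c₁ * lam * ε ^ 2) (σ ^ 2 * G * Real.sqrt ι)) ↔
      β ≤ 1 ∧ β * (σ ^ 2 * G * Real.sqrt ι) ≤ c₁ * lam * ε ^ 2 := by
  have h := ofReal_le_ofReal_mul_extDiv_iff (w := β) (c := 1) (a := c₁ * lam * ε ^ 2)
    (b := σ ^ 2 * G * Real.sqrt ι) one_pos (by positivity) (by positivity)
  rw [ENNReal.ofReal_one, one_mul, one_mul] at h
  rw [le_min_iff, h, ENNReal.ofReal_le_one]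

end Parameters

/-! ### Measurability of the iterates in the samples. -/

section Measurability

variable {d : ℕ} {Ω : Type u} {Ξ : Type v} [MeasurableSpace Ξ]

/-- The σ-algebra `m` is arbitrary, so that the members of the sample filtration can be inserted. -/
theorem measurable_adamState {m : MeasurableSpace Ω} {g : RVec d → Ξ → RVec d} {β β₂ η lam : ℝ}
    {xinit : RVec d} {ξ : ℕ → Ω → Ξ} (hg : Measurable (Function.uncurry g)) {k : ℕ}
    (hξ : ∀ s, 1 ≤ s → s ≤ k → Measurable (ξ s)) :
    Measurable (fun ω => (adamState g β β₂ η lam xinit (fun s => ξ s ω) k).m) ∧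
    Measurable (fun ω => (adamState g β β₂ η lam xinit (fun s => ξ s ω) k).v) ∧
    Measurable (fun ω => (adamState g β β₂ η lam xinit (fun s => ξ s ω) k).x) := by
  induction k with
  | zero => exact ⟨measurable_const, measurable_const, measurable_const⟩
  | succ k ih =>
    obtain ⟨hm, hv, hx⟩ := ih fun s h1 h2 => hξ s h1 (h2.trans k.le_succ)
    have hgs : Measurable fun ω => g (adamState g β β₂ η lam xinit (fun s => ξ s ω) k).x
        (ξ (k + 1) ω) := hg.comp (hx.prodMk (hξ (k + 1) (by omega) le_rfl))
    have hc : ∀ {u : Ω → RVec d}, Measurable u → ∀ i, Measurable fun ω => u ω i :=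
      fun hu i => (EuclideanSpace.proj (𝕜 := ℝ) i).continuous.measurable.comp hu
    have hto : ∀ {u : Ω → Fin d → ℝ}, (∀ i, Measurable fun ω => u ω i) →
        Measurable fun ω => (WithLp.toLp 2 (u ω) : RVec d) := fun hu =>
      (WithLp.measurable_toLp 2 _).comp (measurable_pi_lambda _ hu)
    have hm' := fun i => ((hc hm i).const_mul (1 - β)).add ((hc hgs i).const_mul β)
    have hv' := fun i => ((hc hv i).const_mul (1 - β₂)).add (((hc hgs i).pow_const 2).const_mul β₂)
    refine ⟨hto hm', hto hv', hto fun i => ?_⟩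
    exact (hc hx i).sub ((((hv' i).div_const _).sqrt.add_const _).const_div _ |>.mul
      ((hm' i).div_const _))

/-- The filtration generated by the samples: at time `k` the samples `ξ 1, …, ξ k` are known. -/
def sampleFiltration {m₀ : MeasurableSpace Ω} (ξ : ℕ → Ω → Ξ) (hξ : ∀ t, Measurable (ξ t)) :
    Filtration ℕ m₀ where
  seq k := samplesBefore ξ (k + 1)
  mono' _ _ hij := iSup₂_le fun s hs => le_iSup₂_of_le s ⟨hs.1, by omega⟩ le_rfl
  le' _ := iSup₂_le fun s _ => (hξ s).comap_le

theorem measurable_sampleFiltration {m₀ : MeasurableSpace Ω} {ξ : ℕ → Ω → Ξ}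
    (hξ : ∀ t, Measurable (ξ t)) {s k : ℕ} (h1 : 1 ≤ s) (h2 : s ≤ k) :
    Measurable[sampleFiltration ξ hξ k] (ξ s) :=
  measurable_iff_comap_le.2 (le_iSup₂_of_le (f := fun s (_ : 1 ≤ s ∧ s < k + 1) =>
    MeasurableSpace.comap (ξ s) inferInstance) s ⟨h1, by omega⟩ le_rfl)

end Measurability

/-! ### Parameter budgets and convergence. -/

section Convergence

/-- Each of the two lower bounds on `G` in terms of the gap handles one summand of `L`, the second
through `G^(2-ρ) G^ρ = G²`; and `7 = 3 + 4`. -/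
theorem effSmooth_mul_gap_le {d : ℕ} {ρ L₀ Lρ lam σ ι Δ₁ n₁ ε c₁ c₂ C₁ G β η : ℝ}
    (h : AdamChoice d ρ L₀ Lρ lam σ ι Δ₁ n₁ ε c₁ c₂ C₁ G β η) (hρ2 : ρ < 2)
    (hLρ : 0 ≤ Lρ) (hΔ : 0 ≤ Δ₁) (hC₁ : 0 ≤ C₁) :
    C₁ * (effSmooth ρ L₀ Lρ G * Real.sqrt d * Δ₁) ≤ 7 * G ^ 2 := by
  have hG := h.G_pos
  have h1 : C₁ * Δ₁ * L₀ * Real.sqrt d ≤ G ^ 2 :=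
    (Real.sqrt_le_left hG.le).1 h.G_ge_L0
  have h2 : C₁ * Δ₁ * Lρ * Real.sqrt d ≤ G ^ (2 - ρ) := by
    have h3 := Real.rpow_le_rpow (z := 2 - ρ) (by positivity) h.G_ge_Lrho (by linarith)
    rwa [← Real.rpow_mul (by positivity), one_div_mul_cancel (by linarith), Real.rpow_one] at h3
  have h3 : C₁ * Δ₁ * Lρ * Real.sqrt d * G ^ ρ ≤ G ^ 2 := by
    calc _ ≤ G ^ (2 - ρ) * G ^ ρ := by gcongr
      _ = G ^ 2 := by
        rw [← Real.rpow_add hG, sub_add_cancel]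
        exact_mod_cast Real.rpow_natCast G 2
  unfold effSmooth
  linarith

/-- Rounding up costs at most `1 ≤ 1/β²`. -/
theorem adamHorizon_le {Δ₁ ε C₂ G β η : ℝ} (hβ : 0 < β) (hβ1 : β ≤ 1)
    (hx : 0 ≤ C₂ * Δ₁ * G / (η * ε ^ 2)) :
    (adamHorizon Δ₁ ε C₂ G β η : ℝ) ≤ 2 / β ^ 2 + C₂ * Δ₁ * G / (η * ε ^ 2) := by
  have h1 : 1 ≤ 1 / β ^ 2 := by
    rw [le_div_iff₀ (by positivity)]
    nlinarith
  have h2 := (Nat.ceil_lt_add_one (a := max (1 / β ^ 2) (C₂ * Δ₁ * G / (η * ε ^ 2)))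
    (by positivity)).le
  have h3 : max (1 / β ^ 2) (C₂ * Δ₁ * G / (η * ε ^ 2)) ≤
      1 / β ^ 2 + C₂ * Δ₁ * G / (η * ε ^ 2) := max_le_add_of_nonneg (by positivity) hx
  have e : 2 / β ^ 2 = 1 / β ^ 2 + 1 / β ^ 2 := by ring
  unfold adamHorizon
  linarith

/-- The budget which keeps the gradients below `G`: `s = √d`, `q = √ι`. -/
theorem gradient_budget {L η s q lam β σ G Δ₁ ε T c₁ c₂ C₁ C₂ : ℝ} (hL : 0 ≤ L)
    (hη : 0 < η) (hs : 0 ≤ s) (hq : 0 ≤ q) (hlam : 0 < lam) (hβ : 0 < β) (hG : 0 < G)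
    (hσ : 0 ≤ σ) (hσG : 2 * σ ≤ G) (hΔ : 0 ≤ Δ₁) (hε : 0 < ε) (hC₁ : 7168 ≤ C₁) (hC₂ : 7168 ≤ C₂)
    (hc₁ : c₁ * C₂ ≤ 1 / 28672) (hc₂ : c₂ ≤ 1 / 28672)
    (hstep : η * (s * q * L) ≤ c₂ * (lam * β))
    (hβle : β * (σ ^ 2 * G * q) ≤ c₁ * lam * ε ^ 2)
    (hgap : C₁ * (L * s * Δ₁) ≤ 7 * G ^ 2)
    (hT : T ≤ 2 / β ^ 2 + C₂ * Δ₁ * G / (η * ε ^ 2)) :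
    16 * (L * (η * s)) * (16 * G * Δ₁ / η + 64 * G / lam * (14 * (σ ^ 2 * β * T * q))) ≤ G ^ 3 := by
  have hgap' : L * s * Δ₁ ≤ G ^ 2 / 1024 := by
    have : 0 ≤ L * s * Δ₁ := by positivity
    nlinarith
  have h1 : 16 * (L * (η * s)) * (16 * G * Δ₁ / η) ≤ G ^ 3 / 4 := by
    have e : 16 * (L * (η * s)) * (16 * G * Δ₁ / η) = 256 * G * (L * s * Δ₁) := by
      field_simp; ring
    rw [e]
    nlinarith [mul_le_mul_of_nonneg_left hgap' hG.le]
  have h2 : 16 * (L * (η * s)) * (64 * G / lam * (14 * (σ ^ 2 * β * T * q))) ≤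
      16 * (L * (η * s)) * (64 * G / lam *
        (14 * (σ ^ 2 * β * (2 / β ^ 2 + C₂ * Δ₁ * G / (η * ε ^ 2)) * q))) := by gcongr
  -- Noise over the part `2/β²` of `T`: controlled by the step size and `σ ≤ G/2`. Here `28672 =
  -- 16·64·14·2`.
  have h3 : 16 * (L * (η * s)) * (64 * G / lam * (14 * (σ ^ 2 * β * (2 / β ^ 2) * q))) ≤
      G ^ 3 / 4 := by
    have e : 16 * (L * (η * s)) * (64 * G / lam * (14 * (σ ^ 2 * β * (2 / β ^ 2) * q))) =
        28672 * σ ^ 2 * G * (η * (s * q * L) / (lam * β)) := by field_simp; ring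
    have h4 : η * (s * q * L) / (lam * β) ≤ 1 / 28672 := by
      rw [div_le_iff₀ (by positivity)]
      exact hstep.trans (by gcongr)
    rw [e]
    have h5 : σ ^ 2 ≤ G ^ 2 / 4 := by nlinarith
    calc 28672 * σ ^ 2 * G * (η * (s * q * L) / (lam * β))
        ≤ 28672 * (G ^ 2 / 4) * G * (1 / 28672) := by gcongr
      _ = G ^ 3 / 4 := by ring
  -- Noise over the other part of `T`: `η` cancels, and the bounds on the gap and on `β` remain.
  -- This is why `c₁` must be small relative to `1/C₂`.
  have h6 : 16 * (L * (η * s)) *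
      (64 * G / lam * (14 * (σ ^ 2 * β * (C₂ * Δ₁ * G / (η * ε ^ 2)) * q))) ≤ G ^ 3 / 4 := by
    have e : 16 * (L * (η * s)) *
        (64 * G / lam * (14 * (σ ^ 2 * β * (C₂ * Δ₁ * G / (η * ε ^ 2)) * q))) =
        14336 * C₂ * G * (L * s * Δ₁) * (β * (σ ^ 2 * G * q) / (lam * ε ^ 2)) := by
      field_simp; ring
    have h7 : β * (σ ^ 2 * G * q) / (lam * ε ^ 2) ≤ c₁ := by
      rw [div_le_iff₀ (by positivity)]
      linarith
    have hc0 : 0 ≤ β * (σ ^ 2 * G * q) / (lam * ε ^ 2) := by positivity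
    rw [e]
    calc 14336 * C₂ * G * (L * s * Δ₁) * (β * (σ ^ 2 * G * q) / (lam * ε ^ 2))
        ≤ 14336 * C₂ * G * (G ^ 2 / 1024) * c₁ := by gcongr
      _ = 14 * G ^ 3 * (c₁ * C₂) := by ring
      _ ≤ 14 * G ^ 3 * (1 / 28672) := by gcongr
      _ ≤ G ^ 3 / 4 := by nlinarith [pow_pos hG 3]
  have e : 16 * (L * (η * s)) * (64 * G / lam *
        (14 * (σ ^ 2 * β * (2 / β ^ 2 + C₂ * Δ₁ * G / (η * ε ^ 2)) * q))) =
      16 * (L * (η * s)) * (64 * G / lam * (14 * (σ ^ 2 * β * (2 / β ^ 2) * q))) +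
      16 * (L * (η * s)) *
        (64 * G / lam * (14 * (σ ^ 2 * β * (C₂ * Δ₁ * G / (η * ε ^ 2)) * q))) := by ring
  rw [mul_add]
  have := pow_pos hG 3
  linarith

/-- The averaged squared gradients are at most `ε²`: here `q = √ι`. -/
theorem average_budget {η q lam β σ G Δ₁ ε T c₁ C₂ : ℝ} (hη : 0 < η) (hlam : 0 < lam)
    (hε : 0 < ε) (hC₂ : 7168 ≤ C₂) (hc₁ : c₁ ≤ 1 / 28672) (hT0 : 0 ≤ T)
    (hβle : β * (σ ^ 2 * G * q) ≤ c₁ * lam * ε ^ 2)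
    (hT : C₂ * Δ₁ * G / (η * ε ^ 2) ≤ T) (hΔG : 0 ≤ Δ₁ * G) :
    16 * G * Δ₁ / η + 64 * G / lam * (14 * (σ ^ 2 * β * T * q)) ≤ ε ^ 2 * T := by
  have h1 : 16 * G * Δ₁ / η ≤ ε ^ 2 * T / 2 := by
    rw [div_le_iff₀ (by positivity)] at hT ⊢
    nlinarith
  have e : 64 * G / lam * (14 * (σ ^ 2 * β * T * q)) =
      896 * T * (β * (σ ^ 2 * G * q) / lam) := by field_simp; ring
  have h2 : β * (σ ^ 2 * G * q) / lam ≤ 1 / 28672 * ε ^ 2 := by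
    rw [div_le_iff₀ hlam]
    refine hβle.trans ?_
    have : c₁ * (lam * ε ^ 2) ≤ 1 / 28672 * (lam * ε ^ 2) := by gcongr
    linarith
  have h3 : 896 * T * (β * (σ ^ 2 * G * q) / lam) ≤ 896 * T * (1 / 28672 * ε ^ 2) := by gcongr
  rw [e]
  nlinarith [mul_nonneg hT0 (sq_nonneg ε)]

theorem expAverage_congr {E : Type*} [AddCommGroup E] [Module ℝ E] {α : ℕ → ℝ} {u w : ℕ → E}
    {k : ℕ} (h : ∀ j ≤ k, u j = w j) : expAverage α u k = expAverage α w k := by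
  induction k with
  | zero => exact h 0 le_rfl
  | succ k ih =>
    rw [expAverage, expAverage, ih fun j hj => h j (hj.trans k.le_succ), h (k + 1) le_rfl]

theorem initialGap_nonneg {d : ℕ} {U : Set (RVec d)} {f : RVec d → ℝ} {x : RVec d} (hx : x ∈ U)
    (hf : BddBelow (f '' U)) : 0 ≤ initialGap U f x :=
  sub_nonneg.2 (csInf_le hf ⟨x, hx, rfl⟩)

/-- The noise agrees almost surely with a bounded process which is adapted and centered. -/
theorem exists_adapted_noise {d : ℕ} {U : Set (RVec d)} {f : RVec d → ℝ} {ρ L₀ Lρ σ : ℝ}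
    {Ω : Type u} {Ξ : Type v} [m₀ : MeasurableSpace Ω] [MeasurableSpace Ξ] {μ : Measure Ω}
    {g : RVec d → Ξ → RVec d} {ξ : ℕ → Ω → Ξ} {xinit : RVec d}
    {β β₂ η lam : ℝ} {T : ℕ} (hU : IsOpen U) (hf : IsL0LrhoSmooth U f ρ L₀ Lρ) (hσ : 0 ≤ σ)
    (hg : Measurable (Function.uncurry g)) (hξ : ∀ t, Measurable (ξ t))
    (hnoise : CenteredBoundedNoise μ f g ξ
      (fun t ω => adamIter g β β₂ η lam xinit (fun s => ξ s ω) t) σ T)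
    (hseg : ∀ᵐ ω ∂μ, ∀ t : ℕ, 1 ≤ t → t ≤ T →
      adamIter g β β₂ η lam xinit (fun s => ξ s ω) t ∈ U) :
    ∃ w : ℕ → Ω → RVec d,
      (∀ k, StronglyMeasurable[sampleFiltration ξ hξ (k + 1)] (w k)) ∧
      (∀ k ω, ‖w k ω‖ ≤ σ) ∧
      (∀ k < T, μ[w k | sampleFiltration ξ hξ k] =ᵐ[μ] 0) ∧
      ∀ᵐ ω ∂μ, ∀ k < T, w k ω =
        g (adamIter g β β₂ η lam xinit (fun s => ξ s ω) (k + 1)) (ξ (k + 1) ω) -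
          gradient f (adamIter g β β₂ η lam xinit (fun s => ξ s ω) (k + 1)) := by
  classical
  set X : ℕ → Ω → RVec d := fun k ω => adamIter g β β₂ η lam xinit (fun s => ξ s ω) (k + 1)
    with hX
  set p : ℕ → Ω → RVec d := fun k ω =>
    g (X k ω) (ξ (k + 1) ω) - U.piecewise (gradient f) 0 (X k ω) with hp
  -- Off `U` the gradient need not be measurable, and the noise is bounded only almost surely.
  -- Replacing the gradient by `0` there and truncating changes nothing almost surely, hence
  -- preserves conditional expectations.
  set w : ℕ → Ω → RVec d := fun k ω => if ‖p k ω‖ ≤ σ then p k ω else 0 with hw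
  have htr : Measurable fun q : RVec d => if ‖q‖ ≤ σ then q else 0 :=
    Measurable.ite (measurableSet_le measurable_norm measurable_const) measurable_id
      measurable_const
  have hgr : Measurable (U.piecewise (gradient f) 0) :=
    (continuousOn_gradient hf).measurable_piecewise continuousOn_const hU.measurableSet
  have heq : ∀ᵐ ω ∂μ, ∀ k < T, w k ω = g (X k ω) (ξ (k + 1) ω) - gradient f (X k ω) := by
    have hb : ∀ᵐ ω ∂μ, ∀ k < T, ‖g (X k ω) (ξ (k + 1) ω) - gradient f (X k ω)‖ ≤ σ := by
      rw [ae_all_iff]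
      intro k
      by_cases hk : k < T
      · filter_upwards [(hnoise (k + 1) (by omega) hk).2] with ω hω _ using hω
      · exact ae_of_all _ fun ω h => absurd h hk
    filter_upwards [hb, hseg] with ω hω hUω k hk
    have h1 : X k ω ∈ U := hUω (k + 1) (by omega) hk
    have h2 : p k ω = g (X k ω) (ξ (k + 1) ω) - gradient f (X k ω) := by
      simp only [hp, Set.piecewise_eq_of_mem _ _ _ h1]
    simp only [hw, h2, if_pos (hω k hk)]
  refine ⟨w, fun k => ?_, fun k ω => ?_, fun k hk => ?_, heq⟩
  · have hXm : Measurable[sampleFiltration ξ hξ (k + 1)] (X k) :=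
      (measurable_adamState (m := sampleFiltration ξ hξ (k + 1)) hg fun s h1 h2 =>
        measurable_sampleFiltration hξ h1 (h2.trans k.le_succ)).2.2
    exact ((htr.comp ((hg.sub (hgr.comp measurable_fst)))).comp
      (hXm.prodMk (measurable_sampleFiltration hξ (by omega) le_rfl))).stronglyMeasurable
  · simp only [hw]
    split_ifs with h
    · exact h
    · simpa using hσ
  · refine (condExp_congr_ae ?_).trans (hnoise (k + 1) (by omega) hk).1
    filter_upwards [heq] with ω hω using hω k hk

/-- The consequences of the step size condition which the analysis of a trajectory uses. -/
theorem AdamChoice.step_bounds {d : ℕ} {ρ L₀ Lρ lam σ ι Δ₁ n₁ ε c₁ c₂ C₁ G β η : ℝ}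
    (h : AdamChoice d ρ L₀ Lρ lam σ ι Δ₁ n₁ ε c₁ c₂ C₁ G β η) (hd : 1 ≤ d) (hL₀ : 0 ≤ L₀)
    (hLρ : 0 ≤ Lρ) (hlam : 0 < lam) (hι : 1 ≤ ι) (hβ1 : β ≤ 1) (hc₂0 : 0 < c₂)
    (hc₂ : c₂ ≤ 1 / 16) :
    effSmooth ρ L₀ Lρ G * η ≤ lam * β / 16 ∧
    (effSmooth ρ L₀ Lρ G * η) ^ 2 * G ≤ lam ^ 3 * β ^ 2 / 128 ∧
    effSmooth ρ L₀ Lρ G * (η * Real.sqrt d) ≤ G / 4 ∧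
    η * (Real.sqrt d * Real.sqrt ι * effSmooth ρ L₀ Lρ G) ≤ c₂ * (lam * β) := by
  have hG := h.G_pos
  have hβ := h.beta_pos
  have hη := h.eta_pos
  obtain ⟨-, he3, he4⟩ := (eta_le_iff hL₀ hLρ hlam hG hβ hc₂0).1 h.eta_le
  rw [Real.sqrt_mul (Nat.cast_nonneg d)] at he3
  set L := effSmooth ρ L₀ Lρ G
  have hL : 0 ≤ L := effSmooth_nonneg hL₀ hLρ hG
  have hd1 : 1 ≤ Real.sqrt d := Real.one_le_sqrt.2 (by exact_mod_cast hd)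
  have hq1 : 1 ≤ Real.sqrt ι := Real.one_le_sqrt.2 hι
  have hle : c₂ * (lam * β) ≤ 1 / 16 * (lam * β) := by gcongr
  have h1 : L * (η * Real.sqrt d) ≤ c₂ * (lam * β) := by
    calc L * (η * Real.sqrt d) ≤ L * (η * Real.sqrt d) * Real.sqrt ι :=
          le_mul_of_one_le_right (by positivity) hq1
      _ = η * (Real.sqrt d * Real.sqrt ι * L) := by ring
      _ ≤ _ := he3
  have h2 : L * η ≤ L * (η * Real.sqrt d) := by
    gcongr
    exact le_mul_of_one_le_right hη.le hd1
  refine ⟨by linarith, ?_, ?_, he3⟩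
  · have h3 : (η * (L * Real.sqrt G)) ^ 2 ≤ (1 / 16 * (lam ^ (3 / 2 : ℝ) * β)) ^ 2 :=
      pow_le_pow_left₀ (by positivity) (he4.trans (by gcongr)) 2
    have e1 : (η * (L * Real.sqrt G)) ^ 2 = (L * η) ^ 2 * G := by
      rw [mul_pow, mul_pow, Real.sq_sqrt hG.le]; ring
    have e2 : (lam ^ (3 / 2 : ℝ)) ^ 2 = lam ^ 3 := by
      rw [← Real.rpow_natCast, ← Real.rpow_mul hlam.le, ← Real.rpow_natCast]
      norm_num
    have e3 : (1 / 16 * (lam ^ (3 / 2 : ℝ) * β)) ^ 2 = 1 / 256 * (lam ^ 3 * β ^ 2) := by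
      rw [mul_pow, mul_pow, e2]; ring
    rw [e1, e3] at h3
    have h4 : 0 ≤ lam ^ 3 * β ^ 2 := by positivity
    linarith
  · have h5 := h.G_ge_lam
    have h6 : lam * β ≤ lam := mul_le_of_le_one_right hlam.le hβ1
    linarith

/-- The bounds along a single path of the iteration which stays in `U` and on which the noise is
bounded and its averages are small. -/
theorem adam_path_bounds {C₁ C₂ c₁ c₂ : ℝ} (hC₁ : 7168 ≤ C₁) (hC₂ : 7168 ≤ C₂)
    (hc₁0 : 0 < c₁) (hc₂0 : 0 < c₂) (hc₁ : c₁ * C₂ ≤ 1 / 28672) (hc₂ : c₂ ≤ 1 / 28672)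
    {d : ℕ} {U : Set (RVec d)} {f : RVec d → ℝ} {ρ L₀ Lρ σ : ℝ} {Ξ : Type v}
    {g : RVec d → Ξ → RVec d} {z : ℕ → Ξ} {xinit : RVec d} {ι ε lam G β η : ℝ} {T : ℕ}
    (hU : IsOpen U) (hx : xinit ∈ U) (hfd : ∀ x ∈ U, DifferentiableAt ℝ f x)
    (hfb : BddBelow (f '' U)) (hρ : 0 ≤ ρ) (hρ2 : ρ < 2) (hL₀ : 0 ≤ L₀) (hLρ : 0 ≤ Lρ)
    (hf : IsL0LrhoSmooth U f ρ L₀ Lρ) (hσ : 0 ≤ σ) (hε : 0 < ε) (hlam : 0 < lam) (hι : 1 ≤ ι)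
    (hch : AdamChoice d ρ L₀ Lρ lam σ ι (initialGap U f xinit) ‖gradient f xinit‖ ε
      c₁ c₂ C₁ G β η)
    (hT : (T : ℝ) ≤ 2 / β ^ 2 + C₂ * initialGap U f xinit * G / (η * ε ^ 2))
    {y A n : ℕ → RVec d} (hy : y = fun k => adamIter g β β η lam xinit z (k + 1))
    (hA : A = fun k => gradient f (y k)) (hn : n = fun k => g (y k) (z (k + 1)) - A k)
    (hnσ : ∀ k < T, ‖n k‖ ≤ σ) (hseg : ∀ k < T, segment ℝ (y k) (y (k + 1)) ⊆ U)
    (hQ : ∑ k ∈ Finset.range T, ‖expAverage (biasWeight β) n k‖ ^ 2 ≤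
      14 * (σ ^ 2 * β * T * Real.sqrt ι)) :
    (∀ k < T, ‖A k‖ ≤ G) ∧ ∑ k ∈ Finset.range T, ‖A k‖ ^ 2 ≤
      16 * G * initialGap U f xinit / η +
        64 * G / lam * (14 * (σ ^ 2 * β * T * Real.sqrt ι)) := by
  have hG := hch.G_pos
  have hβ := hch.beta_pos
  have hη := hch.eta_pos
  obtain ⟨hβ1, hβle⟩ := (beta_le_iff hlam hG hε hc₁0).1 hch.beta_le
  obtain ⟨⟨he1, he2⟩, -⟩ := (eta_le_iff hL₀ hLρ hlam hG hβ hc₂0).1 hch.eta_le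
  have hΔ := initialGap_nonneg hx hfb
  -- For `d = 0` the factor `√d` vanishes and one of the step size bounds is void, but all gradients
  -- are zero.
  rcases Nat.eq_zero_or_pos d with rfl | hd
  · have hzero : ∀ k, ‖A k‖ = 0 := fun k => by rw [Subsingleton.elim (A k) 0, norm_zero]
    refine ⟨fun k _ => (hzero k).le.trans hG.le, ?_⟩
    rw [Finset.sum_eq_zero fun k _ => by rw [hzero, zero_pow two_ne_zero]]
    positivity
  obtain ⟨hb1, hb2, hb3, hb4⟩ := hch.step_bounds hd hL₀ hLρ hlam hι hβ1 hc₂0 (by linarith)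
  have hL := effSmooth_nonneg (ρ := ρ) hL₀ hLρ hG
  have hαβ := le_biasWeight hβ hβ1
  have hα1 := biasWeight_le_one hβ hβ1
  have htraj : IsAdamTrajectory (biasWeight β) η lam (fun k => A k + n k) y := by
    have e : (fun k => A k + n k) = fun k => g (y k) (z (k + 1)) := by
      funext k; simp [hn]
    rw [e, hy]
    exact isAdamTrajectory_adamIter hβ hβ1
  have hstep := htraj.norm_step_le_sqrt (fun k => hβ.le.trans (hαβ k)) hα1 hη.le hlam
  have hy0 : y 0 = xinit := by rw [hy]; rfl
  have hyU : ∀ k ≤ T, y k ∈ U := by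
    intro k hk
    cases k with
    | zero => rwa [hy0]
    | succ k => exact hseg k hk (right_mem_segment ℝ _ _)
  refine htraj.gradient_bounds (σ := σ) (F := fun k => f (y k)) hβ hαβ hα1 hη hlam
    hch.G_ge_lam hch.G_ge_sigma hL hb1 hb2 hb3 hnσ ?_ (fun k hk hAk => ?_) (fun k hk => ?_) hQ ?_
  · rw [show A 0 = gradient f xinit by simp only [hA, hy0]]
    exact hch.G_ge_grad
  · rw [hA] at hAk ⊢
    refine smooth_step hU hfd hf hρ hρ2 hL₀ hLρ hG (w := η * Real.sqrt d) ?_ (fun h1 h2 => ?_)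
      (hseg k hk) hAk (hstep k)
    · rw [mul_right_comm, mul_assoc]
      linarith
    · have := he2 h1 h2
      rw [mul_right_comm, mul_assoc]
      linarith
  · have h1 : sInf (f '' U) ≤ f (y k) := csInf_le hfb ⟨y k, hyU k hk, rfl⟩
    rw [hy0, initialGap]
    linarith
  · exact gradient_budget hL hη (Real.sqrt_nonneg _) (Real.sqrt_nonneg _) hlam hβ hG hσ
      hch.G_ge_sigma hΔ hε hC₁ hC₂ hc₁ hc₂ hb4 hβle
      (effSmooth_mul_gap_le hch hρ2 hLρ hΔ (by linarith)) hT

theorem adam_convergence {C₁ C₂ c₁ c₂ : ℝ} (hC₁ : 7168 ≤ C₁) (hC₂ : 7168 ≤ C₂) (hc₁0 : 0 < c₁)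
    (hc₂0 : 0 < c₂) (hc₁ : c₁ ≤ 1 / (28672 * C₂)) (hc₂ : c₂ ≤ 1 / (28672 * C₂))
    {d : ℕ} {U : Set (RVec d)} {f : RVec d → ℝ} {ρ L₀ Lρ σ : ℝ}
    {Ω : Type u} {Ξ : Type v} [m₀ : MeasurableSpace Ω] [MeasurableSpace Ξ]
    {μ : Measure Ω} [IsProbabilityMeasure μ]
    {g : RVec d → Ξ → RVec d} {ξ : ℕ → Ω → Ξ} {xinit : RVec d} {δ ε lam G β η : ℝ} {T : ℕ}
    (hU : IsOpen U) (hx : xinit ∈ U) (hfd : ∀ x ∈ U, DifferentiableAt ℝ f x)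
    (hfb : BddBelow (f '' U)) (hρ : 0 ≤ ρ) (hρ2 : ρ < 2) (hL₀ : 0 ≤ L₀) (hLρ : 0 ≤ Lρ)
    (hf : IsL0LrhoSmooth U f ρ L₀ Lρ) (hσ : 0 ≤ σ) (hδ : 0 < δ) (hε : 0 < ε)
    (hlam : 0 < lam) (hg : Measurable (Function.uncurry g)) (hξ : ∀ t, Measurable (ξ t))
    (hch : AdamChoice d ρ L₀ Lρ lam σ (logFactor δ) (initialGap U f xinit) ‖gradient f xinit‖ ε
      c₁ c₂ C₁ G β η)
    (hT : T = adamHorizon (initialGap U f xinit) ε C₂ G β η)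
    (hnoise : CenteredBoundedNoise μ f g ξ
      (fun t ω => adamIter g β β η lam xinit (fun s => ξ s ω) t) σ T)
    (hseg : ∀ᵐ ω ∂μ, ∀ t : ℕ, 1 ≤ t → t ≤ T →
      segment ℝ (adamIter g β β η lam xinit (fun s => ξ s ω) t)
        (adamIter g β β η lam xinit (fun s => ξ s ω) (t + 1)) ⊆ U) :
    ENNReal.ofReal (1 - δ) ≤
      μ {ω | (∀ t : ℕ, 1 ≤ t → t ≤ T →
            ‖gradient f (adamIter g β β η lam xinit (fun s => ξ s ω) t)‖ ≤ G) ∧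
          1 / (T : ℝ) * ∑ t ∈ Finset.Icc 1 T,
            ‖gradient f (adamIter g β β η lam xinit (fun s => ξ s ω) t)‖ ^ 2 ≤ ε ^ 2} := by
  have hG := hch.G_pos
  have hβ := hch.beta_pos
  have hη := hch.eta_pos
  obtain ⟨hβ1, hβle⟩ := (beta_le_iff hlam hG hε hc₁0).1 hch.beta_le
  set ι := logFactor δ with hι
  have hι1 : 1 ≤ ι := le_max_left _ _
  set Δ₁ := initialGap U f xinit with hΔ₁
  have hΔ : 0 ≤ Δ₁ := initialGap_nonneg hx hfb
  have hC₂0 : 0 < C₂ := by linarith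
  have hc₁C : c₁ * C₂ ≤ 1 / 28672 := by
    rw [le_div_iff₀ (by positivity)] at hc₁
    linarith
  have hcle : 1 / (28672 * C₂) ≤ 1 / 28672 := by
    gcongr
    linarith
  have hc₁' := hc₁.trans hcle
  have hc₂' := hc₂.trans hcle
  have hTub : (T : ℝ) ≤ 2 / β ^ 2 + C₂ * Δ₁ * G / (η * ε ^ 2) := by
    rw [hT]
    exact adamHorizon_le hβ hβ1 (by positivity)
  have hTmax : max (1 / β ^ 2) (C₂ * Δ₁ * G / (η * ε ^ 2)) ≤ T := by
    rw [hT]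
    exact Nat.le_ceil _
  have hT1 : 1 ≤ β ^ 2 * T := by
    have := (le_max_left _ _).trans hTmax
    rw [div_le_iff₀ (by positivity)] at this
    linarith
  have hTpos : (0 : ℝ) < T := by
    by_contra! h
    nlinarith [sq_nonneg β]
  set α := biasWeight β with hα
  have hsegU : ∀ᵐ ω ∂μ, ∀ t : ℕ, 1 ≤ t → t ≤ T →
      adamIter g β β η lam xinit (fun s => ξ s ω) t ∈ U := by
    filter_upwards [hseg] with ω hω t h1 h2 using hω t h1 h2 (left_mem_segment ℝ _ _)
  obtain ⟨w, hwm, hwσ, hw0, hweq⟩ := exists_adapted_noise hU hf hσ hg hξ hnoise hsegU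
  set Q := 14 * (σ ^ 2 * β * T * Real.sqrt ι) with hQ
  have htail := measure_sum_sq_expAverage_gt_le (μ := μ) (sampleFiltration ξ hξ) hwm hwσ hw0 hβ
    hβ1 hT1 hσ hδ
  set bad := {ω | Q < ∑ k ∈ Finset.range T, ‖expAverage α (fun j => w j ω) k‖ ^ 2} with hbad
  set good := {ω | (∀ t : ℕ, 1 ≤ t → t ≤ T →
            ‖gradient f (adamIter g β β η lam xinit (fun s => ξ s ω) t)‖ ≤ G) ∧
          1 / (T : ℝ) * ∑ t ∈ Finset.Icc 1 T,
            ‖gradient f (adamIter g β β η lam xinit (fun s => ξ s ω) t)‖ ^ 2 ≤ ε ^ 2} with hgood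
  have hmain : ∀ᵐ ω ∂μ, ω ∈ good ∪ bad := by
    filter_upwards [hseg, hweq] with ω hω hwω
    by_contra hnot
    have hnb : ∑ k ∈ Finset.range T, ‖expAverage α (fun j => w j ω) k‖ ^ 2 ≤ Q := by
      by_contra! h
      exact hnot (Or.inr h)
    refine hnot (Or.inl ?_)
    set y : ℕ → RVec d := fun k => adamIter g β β η lam xinit (fun s => ξ s ω) (k + 1) with hy
    set A : ℕ → RVec d := fun k => gradient f (y k) with hA
    set n : ℕ → RVec d := fun k => g (y k) (ξ (k + 1) ω) - A k with hn
    have hbounds := adam_path_bounds hC₁ hC₂ hc₁0 hc₂0 hc₁C hc₂' (g := g) (z := fun s => ξ s ω)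
      hU hx hfd hfb hρ hρ2 hL₀ hLρ hf hσ hε hlam hι1 hch hTub hy hA hn
      (fun k hk => by simpa only [hwω k hk] using hwσ k ω)
      (fun k hk => hω (k + 1) (by omega) hk)
      (by
        refine le_trans (le_of_eq (Finset.sum_congr rfl fun k hk => ?_)) hnb
        rw [expAverage_congr fun j hj => (hwω j (by
          have := Finset.mem_range.1 hk
          omega)).symm])
    refine ⟨fun t h1 h2 => ?_, ?_⟩
    · have := hbounds.1 (t - 1) (by omega)
      simpa only [hA, hy, Nat.sub_add_cancel h1] using this
    · have e : ∑ t ∈ Finset.Icc 1 T,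
          ‖gradient f (adamIter g β β η lam xinit (fun s => ξ s ω) t)‖ ^ 2 =
          ∑ k ∈ Finset.range T, ‖A k‖ ^ 2 := by
        rw [Finset.range_eq_Ico, ← Finset.Ico_add_one_right_eq_Icc,
          ← Finset.sum_Ico_add' _ 0 T 1]
      rw [e, one_div, inv_mul_le_iff₀ hTpos]
      have h3 := average_budget hη hlam hε hC₂ hc₁' hTpos.le hβle
        ((le_max_right _ _).trans hTmax) (by positivity)
      linarith [hbounds.2]
  -- Only subadditivity is used, so the good event need not be measurable.
  have h1 : 1 ≤ μ good + ENNReal.ofReal δ := by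
    calc (1 : ℝ≥0∞) = μ Set.univ := measure_univ.symm
      _ ≤ μ (good ∪ bad) := measure_mono_ae (hmain.mono fun ω h _ => h)
      _ ≤ μ good + μ bad := measure_union_le _ _
      _ ≤ _ := by gcongr
  rw [ENNReal.ofReal_sub _ hδ.le, ENNReal.ofReal_one]
  exact tsub_le_iff_right.2 h1

end Convergence

/-! ### Dimension dependence of the complexity. -/

section Complexity

/-- The powers of the dimension `D` that occur in the complexity estimate. -/
theorem dimension_powers {ρ a p D : ℝ} (hρ : 0 ≤ ρ) (ha0 : 0 < a) (ha : a * (2 - ρ) = 1 / 2)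
    (hp1 : 4 * a ≤ p) (hp2 : a * (5 + 2 * ρ) / 2 ≤ p) (hD : 1 ≤ D) :
    D ^ (a - p) * ((D ^ a) ^ (ρ - 1) * Real.sqrt D) ≤ 1 ∧
    D ^ (a - p) * Real.sqrt D ≤ 1 ∧
    D ^ (a - p) * (Real.sqrt D * (D ^ a) ^ ρ) * D ^ a ≤ 1 ∧
    D ^ (a - p) * ((D ^ a) ^ ρ * Real.sqrt (D ^ a)) * D ^ a ≤ 1 ∧
    (D ^ a) ^ 2 ≤ D ^ p ∧ Real.sqrt (Real.sqrt D) ≤ D ^ a := by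
  have hD0 : 0 < D := by linarith
  have haρ : a * ρ = 2 * a - 1 / 2 := by linarith
  have ha4 : 1 / 4 ≤ a := by nlinarith
  simp only [Real.sqrt_eq_rpow, ← Real.rpow_natCast, ← Real.rpow_mul hD0.le,
    ← Real.rpow_add hD0]
  refine ⟨?_, ?_, ?_, ?_, Real.rpow_le_rpow_of_exponent_le hD ?_,
    Real.rpow_le_rpow_of_exponent_le hD ?_⟩
  any_goals apply Real.rpow_le_one_of_one_le_of_nonpos hD
  all_goals push_cast; nlinarith

/-- With `r` a sum of ratios, the single number `1/(1 + r)` satisfies several upper bounds at once.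
-/
theorem inv_one_add_sum_mul_le {x y r : ℝ} (hx : 0 ≤ x) (hy : 0 < y) (hr : x / y ≤ r) :
    1 / (1 + r) * x ≤ y := by
  have hr0 : 0 ≤ r := (by positivity : 0 ≤ x / y).trans hr
  rw [div_le_iff₀ hy] at hr
  rw [one_div, inv_mul_le_iff₀ (by positivity)]
  nlinarith

/-- An admissible choice of the parameters with `G = A d^a`, `β` of order `ε² / G` and `η` of order
`ε² d^(a - p)`. -/
theorem exists_adamChoice {C₁ C₂ c₁ c₂ : ℝ} (hC₁ : 0 ≤ C₁) (hC₂ : 0 ≤ C₂) (hc₁ : 0 < c₁)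
    (hc₂ : 0 < c₂) {ρ L₀ Lρ lam σ ι Δ₁ n₁ a p A Λ b e : ℝ} (hρ : 0 ≤ ρ) (hρ2 : ρ < 2)
    (hL₀ : 0 ≤ L₀) (hLρ : 0 ≤ Lρ) (hlam : 0 < lam) (hΔ : 0 ≤ Δ₁)
    (ha0 : 0 < a) (hau : a * (2 - ρ) = 1 / 2) (hp1 : 4 * a ≤ p)
    (hp2 : a * (5 + 2 * ρ) / 2 ≤ p) (hA1 : 1 ≤ A) (hAlam : 2 * lam ≤ A) (hAσ : 2 * σ ≤ A)
    (hAn : 2 * n₁ ≤ A) (hAZ : Real.sqrt (C₁ * Δ₁ * L₀) ≤ A)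
    (hAY : (C₁ * Δ₁ * Lρ) ^ (1 / (2 - ρ)) ≤ A) (hΛ : Λ = 3 * L₀ + 4 * Lρ * A ^ ρ)
    (hb0 : 0 < b) (hb1 : b ≤ 1) (hbσ : b * (σ ^ 2 * Real.sqrt ι) ≤ c₁ * lam) (he0 : 0 < e)
    (h1 : e * (5 * Lρ * A ^ (ρ - 1)) ≤ c₂) (h2 : e * (5 * (L₀ ^ (ρ - 1) * Lρ) ^ (1 / ρ)) ≤ c₂)
    (h3 : e * (A * Real.sqrt ι * Λ) ≤ c₂ * (lam * b))
    (h4 : e * (A * Real.sqrt A * Λ) ≤ c₂ * (lam ^ (3 / 2 : ℝ) * b))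
    {d : ℕ} {ε : ℝ} (hd : 1 ≤ d) (hε : 0 < ε) (hε1 : ε ≤ 1) :
    ∃ G β η : ℝ, AdamChoice d ρ L₀ Lρ lam σ ι Δ₁ n₁ ε c₁ c₂ C₁ G β η ∧
      (adamHorizon Δ₁ ε C₂ G β η : ℝ) ≤
        (2 * A ^ 2 / b ^ 2 + C₂ * Δ₁ * A / e) * (d : ℝ) ^ p / ε ^ 4 := by
  have hA0 : 0 < A := by linarith
  have hu : 0 < 2 - ρ := by linarith
  have hΛ0 : 0 ≤ Λ := by rw [hΛ]; positivity
  set q := Real.sqrt ι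
  have hq0 : 0 ≤ q := Real.sqrt_nonneg _
  set R := (L₀ ^ (ρ - 1) * Lρ) ^ (1 / ρ) with hR
  have hR0 : 0 ≤ R := by positivity
  set D : ℝ := (d : ℝ) with hDdef
  have hD1 : 1 ≤ D := by rw [hDdef]; exact_mod_cast hd
  have hD0 : 0 < D := by linarith
  obtain ⟨k1, k2, k3, k4, k5, k6⟩ := dimension_powers hρ ha0 hau hp1 hp2 hD1
  set Da := D ^ a with hDa
  have hDa0 : 0 < Da := by positivity
  have hDa1 : 1 ≤ Da := Real.one_le_rpow hD1 ha0.le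
  have hε2 : ε ^ 2 ≤ 1 := pow_le_one₀ hε.le hε1
  set s := Real.sqrt D with hs
  have hs0 : 0 ≤ s := Real.sqrt_nonneg _
  set G := A * Da with hGdef
  have hG0 : 0 < G := by positivity
  have hAG : A ≤ G := le_mul_of_one_le_right hA0.le hDa1
  set β := b * ε ^ 2 / G with hβdef
  have hβ0 : 0 < β := by positivity
  have hβ1 : β ≤ 1 := by
    rw [hβdef, div_le_one hG0]
    calc b * ε ^ 2 ≤ 1 * 1 := by gcongr
      _ ≤ G := by linarith
  set η := e * ε ^ 2 * D ^ (a - p) with hηdef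
  have hη0 : 0 < η := by positivity
  have hDp0 : 0 < D ^ (a - p) := by positivity
  have hL : effSmooth ρ L₀ Lρ G ≤ Λ * Da ^ ρ := by
    have : (1 : ℝ) ≤ Da ^ ρ := Real.one_le_rpow hDa1 hρ
    rw [effSmooth, hGdef, Real.mul_rpow hA0.le hDa0.le, hΛ]
    have h0 : 3 * L₀ ≤ 3 * L₀ * Da ^ ρ := le_mul_of_one_le_right (by positivity) this
    linarith
  refine ⟨G, β, η, ⟨hG0, by linarith, by linarith, by linarith, ?_, ?_, hβ0,
    (beta_le_iff hlam hG0 hε hc₁).2 ⟨hβ1, ?_⟩, hη0,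
    (eta_le_iff hL₀ hLρ hlam hG0 hβ0 hc₂).2 ⟨⟨?_, fun _ _ => ?_⟩, ?_, ?_⟩⟩, ?_⟩
  · rw [Real.sqrt_mul (by positivity)]
    exact mul_le_mul hAZ k6 (Real.sqrt_nonneg _) hA0.le
  · rw [Real.mul_rpow (by positivity) hs0]
    -- The lower bound on `G` involving `Lρ` fixes the exponent `a = 1/(2(2 - ρ))`.
    have hsD : s ^ (1 / (2 - ρ)) = Da := by
      rw [hs, hDa, Real.sqrt_eq_rpow, ← Real.rpow_mul hD0.le]
      congr 1
      rw [div_mul_div_comm, one_mul, div_eq_iff (by positivity)]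
      linarith
    rw [hsD]
    exact mul_le_mul_of_nonneg_right hAY hDa0.le
  · calc β * (σ ^ 2 * G * q) = b * (σ ^ 2 * q) * ε ^ 2 := by rw [hβdef]; field_simp
      _ ≤ _ := by gcongr
  · calc η * (5 * Lρ * G ^ (ρ - 1) * s)
        = e * (5 * Lρ * A ^ (ρ - 1)) * (ε ^ 2 * (D ^ (a - p) * (Da ^ (ρ - 1) * s))) := by
          rw [hηdef, hGdef, Real.mul_rpow hA0.le hDa0.le]; ring
      _ ≤ c₂ * (1 * 1) := by gcongr
      _ = c₂ := by ring
  · calc η * (5 * R * s) = e * (5 * R) * (ε ^ 2 * (D ^ (a - p) * s)) := by rw [hηdef]; ring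
      _ ≤ c₂ * (1 * 1) := by gcongr
      _ = c₂ := by ring
  · rw [Real.sqrt_mul hD0.le]
    calc η * (s * q * effSmooth ρ L₀ Lρ G) ≤ η * (s * q * (Λ * Da ^ ρ)) := by gcongr
      _ = e * (A * q * Λ) * (D ^ (a - p) * (s * Da ^ ρ) * Da) * (ε ^ 2 / G) := by
          rw [hηdef, hGdef]; field_simp
      _ ≤ c₂ * (lam * b) * 1 * (ε ^ 2 / G) := by gcongr
      _ = c₂ * (lam * β) := by rw [hβdef]; ring
  · calc η * (effSmooth ρ L₀ Lρ G * Real.sqrt G) ≤ η * (Λ * Da ^ ρ * Real.sqrt G) := by gcongr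
      _ = e * (A * Real.sqrt A * Λ) * (D ^ (a - p) * (Da ^ ρ * Real.sqrt Da) * Da) *
            (ε ^ 2 / G) := by
          rw [hηdef, hGdef, Real.sqrt_mul hA0.le]; field_simp
      _ ≤ c₂ * (lam ^ (3 / 2 : ℝ) * b) * 1 * (ε ^ 2 / G) := by gcongr
      _ = c₂ * (lam ^ (3 / 2 : ℝ) * β) := by rw [hβdef]; ring
  · refine (adamHorizon_le hβ0 hβ1 (by positivity)).trans ?_
    -- This term grows only like `d^(2a)`; the next one has the order `d^p` exactly.
    have e1 : 2 / β ^ 2 = 2 * A ^ 2 / b ^ 2 * Da ^ 2 / ε ^ 4 := by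
      rw [hβdef, hGdef]; field_simp
    have e2 : C₂ * Δ₁ * G / (η * ε ^ 2) = C₂ * Δ₁ * A / e * D ^ p / ε ^ 4 := by
      rw [hηdef, hGdef, hDa, Real.rpow_sub hD0]; field_simp
    have h5 : 2 * A ^ 2 / b ^ 2 * Da ^ 2 / ε ^ 4 ≤ 2 * A ^ 2 / b ^ 2 * D ^ p / ε ^ 4 := by gcongr
    rw [e1, e2, add_mul, add_div]
    linarith

theorem adam_complexity {C₁ C₂ c₁ c₂ : ℝ} (hC₁ : 0 ≤ C₁) (hC₂ : 0 ≤ C₂) (hc₁ : 0 < c₁)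
    (hc₂ : 0 < c₂) {ρ L₀ Lρ lam σ δ Δ₁ n₁ : ℝ} (hρ : 0 ≤ ρ) (hρ2 : ρ < 2) (hL₀ : 0 ≤ L₀)
    (hLρ : 0 ≤ Lρ) (hlam : 0 < lam) (hσ : 0 ≤ σ) (hΔ : 0 ≤ Δ₁) (hn₁ : 0 ≤ n₁) :
    ∃ K : ℝ, 0 < K ∧ ∀ (d : ℕ) (ε : ℝ), 1 ≤ d → 0 < ε → ε ≤ 1 →
      ∃ G β η : ℝ,
        AdamChoice d ρ L₀ Lρ lam σ (logFactor δ) Δ₁ n₁ ε c₁ c₂ C₁ G β η ∧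
        (adamHorizon Δ₁ ε C₂ G β η : ℝ) ≤
          K * (d : ℝ) ^ max (2 / (2 - ρ)) ((5 + 2 * ρ) / (4 * (2 - ρ))) / ε ^ 4 := by
  set ι := logFactor δ
  set p := max (2 / (2 - ρ)) ((5 + 2 * ρ) / (4 * (2 - ρ)))
  have hu : 0 < 2 - ρ := by linarith
  set a := 1 / (2 * (2 - ρ)) with ha
  have ha0 : 0 < a := by positivity
  have hau : a * (2 - ρ) = 1 / 2 := by rw [ha]; field_simp
  have hp1 : 4 * a ≤ p := by
    refine le_trans (le_of_eq ?_) (le_max_left _ _)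
    rw [ha]; field_simp; norm_num
  have hp2 : a * (5 + 2 * ρ) / 2 ≤ p := by
    refine le_trans (le_of_eq ?_) (le_max_right _ _)
    rw [ha]; field_simp; norm_num
  set Y := (C₁ * Δ₁ * Lρ) ^ (1 / (2 - ρ)) with hY
  have hY0 : 0 ≤ Y := by positivity
  set Z := Real.sqrt (C₁ * Δ₁ * L₀) with hZ
  have hZ0 : 0 ≤ Z := Real.sqrt_nonneg _
  -- A sum of nonnegative terms dominates every dimension-free lower bound on `G`.
  set A := 1 + 2 * lam + 2 * σ + 2 * n₁ + Z + Y with hA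
  have hA1 : 1 ≤ A := by rw [hA]; linarith
  have hA0 : 0 < A := by linarith
  set Λ := 3 * L₀ + 4 * Lρ * A ^ ρ with hΛ
  have hΛ0 : 0 ≤ Λ := by positivity
  set q := Real.sqrt ι
  have hq0 : 0 ≤ q := Real.sqrt_nonneg _
  set b := 1 / (1 + σ ^ 2 * q / (c₁ * lam)) with hb
  have hb0 : 0 < b := by positivity
  have hb1 : b ≤ 1 := by
    rw [hb, div_le_one (by positivity)]
    exact le_add_of_nonneg_right (by positivity)
  have hbσ : b * (σ ^ 2 * q) ≤ c₁ * lam :=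
    inv_one_add_sum_mul_le (by positivity) (by positivity) le_rfl
  set R := (L₀ ^ (ρ - 1) * Lρ) ^ (1 / ρ) with hR
  have hR0 : 0 ≤ R := by positivity
  set r₁ := 5 * Lρ * A ^ (ρ - 1) / c₂ with hr₁
  set r₂ := 5 * R / c₂ with hr₂
  set r₃ := A * q * Λ / (c₂ * (lam * b)) with hr₃
  set r₄ := A * Real.sqrt A * Λ / (c₂ * (lam ^ (3 / 2 : ℝ) * b)) with hr₄
  have hr₁0 : 0 ≤ r₁ := by positivity
  have hr₂0 : 0 ≤ r₂ := by positivity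
  have hr₃0 : 0 ≤ r₃ := by positivity
  have hr₄0 : 0 ≤ r₄ := by positivity
  set e := 1 / (1 + (r₁ + r₂ + r₃ + r₄)) with he
  have he0 : 0 < e := by positivity
  have h1 : e * (5 * Lρ * A ^ (ρ - 1)) ≤ c₂ :=
    inv_one_add_sum_mul_le (by positivity) hc₂ (by linarith)
  have h2 : e * (5 * R) ≤ c₂ := inv_one_add_sum_mul_le (by positivity) hc₂ (by linarith)
  have h3 : e * (A * q * Λ) ≤ c₂ * (lam * b) :=
    inv_one_add_sum_mul_le (by positivity) (by positivity) (by linarith)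
  have h4 : e * (A * Real.sqrt A * Λ) ≤ c₂ * (lam ^ (3 / 2 : ℝ) * b) :=
    inv_one_add_sum_mul_le (by positivity) (by positivity) (by linarith)
  exact ⟨2 * A ^ 2 / b ^ 2 + C₂ * Δ₁ * A / e, by positivity, fun d ε hd hε hε1 =>
    exists_adamChoice hC₁ hC₂ hc₁ hc₂ hρ hρ2 hL₀ hLρ hlam hΔ ha0 hau hp1 hp2 hA1 (by linarith)
      (by linarith) (by linarith) (by linarith) (by linarith) hΛ hb0 hb1 hbσ he0 h1 h2 h3 h4
      hd hε hε1⟩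

end Complexity

theorem mainTheorem1 :
    ∃ C₀ : ℝ, 0 < C₀ ∧ ∀ C₁ C₂ : ℝ, C₀ ≤ C₁ → C₀ ≤ C₂ →
    ∃ c₀ : ℝ, 0 < c₀ ∧ ∀ c₁ c₂ : ℝ, 0 < c₁ → c₁ ≤ c₀ → 0 < c₂ → c₂ ≤ c₀ →
    -- convergence with probability at least `1 - δ`
    (∀ (d : ℕ) (U : Set (RVec d)) (f : RVec d → ℝ) (ρ L₀ Lρ σ : ℝ)
        (Ω : Type u) (Ξ : Type v) [MeasurableSpace Ω] [MeasurableSpace Ξ]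
        (μ : Measure Ω) [IsProbabilityMeasure μ]
        (g : RVec d → Ξ → RVec d) (ξ : ℕ → Ω → Ξ) (xinit : RVec d)
        (δ ε lam G β β₂ η : ℝ) (T : ℕ),
        IsOpen U → xinit ∈ U →
        (∀ x ∈ U, DifferentiableAt ℝ f x) → BddBelow (f '' U) →
        0 ≤ ρ → ρ < 2 → 0 ≤ L₀ → 0 ≤ Lρ → IsL0LrhoSmooth U f ρ L₀ Lρ →
        0 ≤ σ → 0 < δ → δ < 1 → 0 < ε → 0 < lam →
        Measurable (Function.uncurry g) → (∀ t, Measurable (ξ t)) →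
        β₂ = β →
        AdamChoice d ρ L₀ Lρ lam σ (logFactor δ) (initialGap U f xinit) ‖gradient f xinit‖ ε
          c₁ c₂ C₁ G β η →
        T = adamHorizon (initialGap U f xinit) ε C₂ G β η →
        CenteredBoundedNoise μ f g ξ
          (fun t ω => adamIter g β β₂ η lam xinit (fun s => ξ s ω) t) σ T →
        -- the iterates run inside the domain `U` of `f` (no condition if `U` is all of `ℝᵈ`)
        (∀ᵐ ω ∂μ, ∀ t : ℕ, 1 ≤ t → t ≤ T →
          segment ℝ (adamIter g β β₂ η lam xinit (fun s => ξ s ω) t)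
            (adamIter g β β₂ η lam xinit (fun s => ξ s ω) (t + 1)) ⊆ U) →
        ENNReal.ofReal (1 - δ) ≤
          μ {ω | (∀ t : ℕ, 1 ≤ t → t ≤ T →
                ‖gradient f (adamIter g β β₂ η lam xinit (fun s => ξ s ω) t)‖ ≤ G) ∧
              1 / (T : ℝ) * ∑ t ∈ Finset.Icc 1 T,
                ‖gradient f (adamIter g β β₂ η lam xinit (fun s => ξ s ω) t)‖ ^ 2 ≤ ε ^ 2}) ∧
    -- gradient complexity: the number of iterations that some admissible choice needs
    (∀ ρ L₀ Lρ lam σ δ Δ₁ n₁ : ℝ,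
        0 ≤ ρ → ρ < 2 → 0 ≤ L₀ → 0 ≤ Lρ → 0 < lam → 0 ≤ σ → 0 < δ → δ < 1 → 0 ≤ Δ₁ → 0 ≤ n₁ →
        ∃ K : ℝ, 0 < K ∧ ∀ (d : ℕ) (ε : ℝ), 1 ≤ d → 0 < ε → ε ≤ 1 →
          ∃ G β η : ℝ,
            AdamChoice d ρ L₀ Lρ lam σ (logFactor δ) Δ₁ n₁ ε c₁ c₂ C₁ G β η ∧
            (adamHorizon Δ₁ ε C₂ G β η : ℝ) ≤
              K * (d : ℝ) ^ max (2 / (2 - ρ)) ((5 + 2 * ρ) / (4 * (2 - ρ))) / ε ^ 4) := by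
  -- `7168 = 7·1024` turns the bound `7G²` of `effSmooth_mul_gap_le` into `L√d Δ₁ ≤ G²/1024`.
  refine ⟨7168, by norm_num, fun C₁ C₂ hC₁ hC₂ =>
    ⟨1 / (28672 * C₂), by positivity, fun c₁ c₂ hc₁0 hc₁ hc₂0 hc₂ => ⟨?_, ?_⟩⟩⟩
  · intro d U f ρ L₀ Lρ σ Ω Ξ _ _ μ _ g ξ xinit δ ε lam G β β₂ η T hU hx hfd hfb hρ hρ2 hL₀ hLρ hf
      hσ hδ _ hε hlam hg hξ hβ₂ hch hT hnoise hseg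
    subst hβ₂
    exact adam_convergence hC₁ hC₂ hc₁0 hc₂0 hc₁ hc₂ hU hx hfd hfb hρ hρ2 hL₀ hLρ hf hσ hδ hε hlam
      hg hξ hch hT hnoise hseg
  · intro ρ L₀ Lρ lam σ δ Δ₁ n₁ hρ hρ2 hL₀ hLρ hlam hσ _ _ hΔ hn₁
    exact adam_complexity (by linarith) (by linarith) hc₁0 hc₂0 hρ hρ2 hL₀ hLρ hlam hσ hΔ hn₁
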